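/- **Setting.** Let $(I,H)$ be a quiver with finitely many arrows between any two vertices ($I$ possibly infinite), with an involution $h\mapsto\bar h$ of $H$ exchanging source $\mathrm{out}(h)$ and target $\mathrm{in}(h)$, and with $\Omega\subset H$ such that $H=\Omega\sqcup\overline\Omega$; put $\varepsilon(h)=1$ for $h\in\Omega$ and $\varepsilon(h)=-1$ for $h\in\overline\Omega$. Let $c_{ij}$ be the number of arrows from $i$ to $j$, and let $A=(a_{ij})$ with $a_{ii}=2-c_{ii}$ and $a_{ij}=-c_{ij}$ for $i\ne j$. Let $\alpha_i$ $(i\in I)$ be the standard basis of $\mathbb Z^{(I)}$, and let $(\sum d_k\alpha_k,\sum e_k\alpha_k)=\sum_k d_ke_k$. For $\alpha\in\bigoplus_i\mathbb Z_{\ge0}\alpha_i$ let $V_\alpha=\bigoplus_k V_k$ be an $I$-graded complex vector space of dimension $\alpha$, $GL_\alpha=\prod_k GL(V_k)$ and $X_\alpha=\bigoplus_{h\in H}\mathrm{Hom}(V_{\mathrm{out}(h)},V_{\mathrm{in}(h)})$. Let $\mathcal N_\alpha\subset X_\alpha$ be the set of $B=(B_h)_h$ such that: (i) there is a complete flag $0=F_0\subset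 F_1\subset\cdots$ of graded subspaces of $V_\alpha$ with $B_hF_k\subset F_k$ for every loop $h\in\overline\Omega$ and $B_hF_k\subset F_{k-1}$ for every other $h\in H$; (ii) $\sum_{\mathrm{out}(h)=k}\varepsilon(h)B_{\bar h}B_h=0$ for all $k\in I$; (iii) $B_h$ is regular semisimple (has pairwise distinct eigenvalues) for every loop $h\in\overline\Omega$. For $i\in I$ let $\varepsilon_i(B)$ be the codimension in $V_i$ of $\mathbb C\langle B\rangle_i\cdot\sum_{h:j\to i,\,j\neq i}\mathrm{Im}\,B_h$, where $\mathbb C\langle B\rangle_i\subset\mathrm{End}(V_i)$ is the subalgebra generated by the $B_h$ for all loops $h\in H$ at $i$; let $\mathcal N_{\alpha,n,i}=\{B\in\mathcal N_\alpha:\varepsilon_i(B)=n\}$. For $l\in\mathbb Z_{\ge 0}$ let $Z_{\alpha,l\alpha_i}$ be the variety of short exact sequences of graded spaces $0\to V_\alpha\xrightarrow{\phi}V_{\alpha+l\alpha_i}\xrightarrow{\phi'}V_{l\alpha_i}\to0$, and let $\mathcal N_{\alpha,l,i;l\alpha_i}$ be the set of $(B,B',B'',\phi,\phi')$ with $B\in\mathcal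 N_{\alpha+l\alpha_i,l,i}$, $B'\in\mathcal N_\alpha$, $B''\in\mathcal N_{l\alpha_i}$, $(\phi,\phi')\in Z_{\alpha,l\alpha_i}$, $\phi B'=B\phi$ and $\phi'B=B''\phi'$. Put $q(B,B',B'',\phi,\phi')=B$ and $p(B,B',B'',\phi,\phi')=(B',B'')$. Let $\mathcal N_{\alpha,0,i}\times^{reg}\mathcal N_{l\alpha_i}$ be the set of $(B',B'')\in\mathcal N_{\alpha,0,i}\times\mathcal N_{l\alpha_i}$ such that $B'_h$ and $B''_h$ have disjoint spectra for every loop $h\in\overline\Omega$ at $i$. All these sets carry the Zariski topology and the regular functions induced from the ambient complex vector spaces. **Proposition.** Let $\alpha=\sum_k d_k\alpha_k$, $i\in I$ and $l\in\mathbb Z_{\ge0}$. (a) The map $q:\mathcal N_{\alpha,l,i;l\alpha_i}\to\mathcal N_{\alpha+l\alpha_i,l,i}$ is a (Zariski locally trivial) principal bundle for $GL_\alpha\times GL_{l\alpha_i}$, acting by $(g,g')\cdot(B,B',B'',\phi,\phi')=(B,gB'g^{-1},g'B''g'^{-1},\phi g^{-1},g'\phi')$. (b) The map $p$, restricted to $\mathcal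 N_{\alpha,l,i;l\alpha_i}$, factors as $$\mathcal N_{\alpha,l,i;l\alpha_i}\xrightarrow{p'}(\mathcal N_{\alpha,0,i}\times^{reg}\mathcal N_{l\alpha_i})\times Z_{\alpha,l\alpha_i}\xrightarrow{p''}\mathcal N_{\alpha,0,i}\times^{reg}\mathcal N_{l\alpha_i},$$ where $p'(B,B',B'',\phi,\phi')=((B',B''),(\phi,\phi'))$, $p''$ is the projection, and $p'$ is an affine fibration of rank $$r=l\Big(\sum_{j\ne i}c_{ij}d_j+(c_{ii}-1)d_i\Big)=(l\alpha_i,(\mathrm{Id}-A)\alpha).$$ That is, Zariski locally on the target, $p'$ is isomorphic to the projection from the product with $\mathbb A^r$, with transition maps that are affine on the fibres (in particular $r\ge0$ if the target is not empty). -/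

import Mathlib

namespace LoopQuiver

universe u v w w' w''

/-! ## Classical algebraic geometry inside complex vector spaces

A (reduced, quasi-affine) variety is given by its set of complex points, a subset of a
finite-dimensional complex vector space, with the induced Zariski topology and the induced
regular functions. -/

section Zariski

variable {E F D : Type*} [AddCommGroup E] [Module ℂ E] [AddCommGroup F] [Module ℂ F]
  [AddCommGroup D] [Module ℂ D]

/-- The algebra of polynomial functions on a vector space: generated by the linear forms. -/
def polyFun (E : Type*) [AddCommGroup E] [Module ℂ E] : Subalgebra ℂ (E → ℂ) :=
  Algebra.adjoin ℂ (Set.range fun f : Module.Dual ℂ E => (f : E → ℂ))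

/-- `U` is an open subset of `S` for the Zariski topology of `S`. -/
def IsZariskiOpenIn (S U : Set E) : Prop :=
  ∃ P : Set (E → ℂ), (∀ f ∈ P, f ∈ polyFun E) ∧ U = {x | x ∈ S ∧ ∃ f ∈ P, f x ≠ 0}

/-- A function is regular on `S` if near every point of `S` it is a quotient of two polynomial
functions.  Values outside `S` play no role. -/
def IsRegularFunOn (S : Set E) (f : E → ℂ) : Prop :=
  ∀ x ∈ S, ∃ a ∈ polyFun E, ∃ b ∈ polyFun E, b x ≠ 0 ∧ ∀ y ∈ S, b y ≠ 0 → f y = a y / b y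

/-- A map to a vector space is regular on `S` if all its linear coordinates are regular. -/
def IsRegularOn (S : Set E) (f : E → F) : Prop :=
  ∀ c : Module.Dual ℂ F, IsRegularFunOn S fun x => c (f x)

/-- `σ : U × Φ → P ∩ q⁻¹(U)` is an isomorphism of varieties over `U`, with inverse `τ`. -/
structure IsTrivialization (P : Set E) (q : E → F) (U : Set F) (Φ : Set D)
    (σ : F × D → E) (τ : E → F × D) : Prop where
  mapsTo : Set.MapsTo σ (U ×ˢ Φ) (P ∩ q ⁻¹' U)
  mapsTo_inv : Set.MapsTo τ (P ∩ q ⁻¹' U) (U ×ˢ Φ)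
  inv_left : Set.LeftInvOn τ σ (U ×ˢ Φ)
  inv_right : Set.RightInvOn τ σ (P ∩ q ⁻¹' U)
  regular : IsRegularOn (U ×ˢ Φ) σ
  regular_inv : IsRegularOn (P ∩ q ⁻¹' U) τ
  over_base : ∀ x ∈ P ∩ q ⁻¹' U, (τ x).1 = q x

/-- The variety underlying the linear algebraic group `Aˣ`, where `A` is a finite-dimensional
algebra: the open subset of invertible elements of `A`. -/
def unitsVariety (A : Type*) [Monoid A] : Set A := Set.range (Units.val : Aˣ → A)

/-- `q : P → M` is a (left, Zariski locally trivial) principal bundle for the linear algebraic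
group `Aˣ` acting on `P` through `act`: the action on `P` is a regular group action along the
fibres of `q`, and locally over `M` the map `q` is equivariantly isomorphic to the projection
`U × Aˣ → U`, where `Aˣ` acts by left multiplication on the second factor. -/
structure IsPrincipalBundle {A : Type*} [Ring A] [Algebra ℂ A] (act : Aˣ → E → E)
    (P : Set E) (M : Set F) (q : E → F) : Prop where
  mapsTo : Set.MapsTo q P M
  regular : IsRegularOn P q
  act_mem : ∀ g, ∀ x ∈ P, act g x ∈ P
  act_one : ∀ x ∈ P, act 1 x = x
  act_mul : ∀ g g', ∀ x ∈ P, act (g * g') x = act g (act g' x)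
  act_regular : ∃ a : A × E → E, IsRegularOn (unitsVariety A ×ˢ P) a ∧
    ∀ (g : Aˣ), ∀ x ∈ P, a (g.val, x) = act g x
  act_fibre : ∀ g, ∀ x ∈ P, q (act g x) = q x
  locally_trivial : ∀ m ∈ M, ∃ U : Set F, m ∈ U ∧ IsZariskiOpenIn M U ∧
    ∃ (σ : F × A → E) (τ : E → F × A), IsTrivialization P q U (unitsVariety A) σ τ ∧
      ∀ u ∈ U, ∀ g g' : Aˣ, σ (u, (g * g').val) = act g (σ (u, g'.val))

/-- `p : P → M` is an affine fibration of rank `r`: there is a covering of `M` by Zariski open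
subsets (here one neighbourhood `U m` for each point `m` of `M`) over which `p` is isomorphic
to the projection `U m × 𝔸ʳ → U m`, and the transition functions are affine on each fibre.
The rank is an integer; it has to be a natural number as soon as `M` is not empty. -/
structure IsAffineFibration (P : Set E) (M : Set F) (p : E → F) (r : ℤ) : Prop where
  mapsTo : Set.MapsTo p P M
  regular : IsRegularOn P p
  locally_trivial : ∃ n : ℕ, (M.Nonempty → (n : ℤ) = r) ∧
    ∃ (U : F → Set F) (σ : F → F × (Fin n → ℂ) → E) (τ : F → E → F × (Fin n → ℂ)),
      (∀ m ∈ M, m ∈ U m ∧ IsZariskiOpenIn M (U m) ∧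
        IsTrivialization P p (U m) Set.univ (σ m) (τ m)) ∧
      ∀ m ∈ M, ∀ m' ∈ M, ∀ u ∈ U m ∩ U m',
        ∃ t : (Fin n → ℂ) →ᵃ[ℂ] (Fin n → ℂ), ∀ z, (τ m' (σ m (u, z))).2 = t z

end Zariski

/-! ## Double quivers and their representations -/

/-- A quiver `(I, H)` with an involution `bar` of its arrows that reverses their direction, and an
orientation `Ω`, so that `H` is the disjoint union of `Ω` and its image under `bar` (in
particular `bar` has no fixed point).  `Arr i j` is the finite set of arrows from `i` to `j`. -/
structure DoubleQuiver (I : Type u) where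
  Arr : I → I → Type v
  finite_arr : ∀ i j, Finite (Arr i j)
  bar : ∀ {i j : I}, Arr i j → Arr j i
  bar_bar : ∀ {i j : I} (h : Arr i j), bar (bar h) = h
  Ω : ∀ {i j : I}, Set (Arr i j)
  bar_mem_Ω : ∀ {i j : I} (h : Arr i j), bar h ∈ Ω ↔ h ∉ Ω

section Cartan

variable {I : Type u} (Q : DoubleQuiver.{u, v} I)

/-- The number of arrows from `i` to `j`. -/
noncomputable def numArr (i j : I) : ℕ := Nat.card (Q.Arr i j)

/-- The Borcherds-Cartan matrix of the quiver. -/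
noncomputable def cartan [DecidableEq I] (i j : I) : ℤ :=
  if i = j then 2 - (numArr Q i i : ℤ) else -(numArr Q i j : ℤ)

/-- The vector `A β`, for `β` in the root lattice. -/
noncomputable def cartanMul [DecidableEq I] (β : I →₀ ℤ) : I → ℤ :=
  fun k => β.sum fun j d => cartan Q k j * d

/-- The pairing `∑ₖ βₖ γₖ` (`γ` may have infinite support). -/
noncomputable def pairing (β : I →₀ ℤ) (γ : I → ℤ) : ℤ := β.sum fun k d => d * γ k

/-- An element of the positive cone of the root lattice as an element of the root lattice. -/
noncomputable def toRoot (α : I →₀ ℕ) : I →₀ ℤ := α.mapRange (fun n : ℕ => (n : ℤ)) rfl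

end Cartan

/-- Families of operators `B = (B_h)_h`, where `B_h : V_i → V_j` for an arrow `h` from `i` to `j`. -/
abbrev Rep {I : Type u} (Q : DoubleQuiver.{u, v} I) (V : I → Type w)
    [∀ k, AddCommGroup (V k)] [∀ k, Module ℂ (V k)] : Type _ :=
  ∀ a b : I, Q.Arr a b → (V a →ₗ[ℂ] V b)

/-- Graded linear maps. -/
abbrev GradedHom {I : Type u} (V : I → Type w) (V' : I → Type w')
    [∀ k, AddCommGroup (V k)] [∀ k, Module ℂ (V k)]
    [∀ k, AddCommGroup (V' k)] [∀ k, Module ℂ (V' k)] : Type _ :=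
  ∀ k : I, (V k →ₗ[ℂ] V' k)

/-- The algebra of graded endomorphisms of `V`; its group of units is the product of the
groups `GL(V_k)`. -/
abbrev GradedEnd {I : Type u} (V : I → Type w)
    [∀ k, AddCommGroup (V k)] [∀ k, Module ℂ (V k)] : Type _ :=
  ∀ k : I, Module.End ℂ (V k)

section Nilpotent

variable {I : Type u} (Q : DoubleQuiver.{u, v} I) (V : I → Type w)
  [∀ k, AddCommGroup (V k)] [∀ k, Module ℂ (V k)]

variable {Q V} in
/-- The component `μ_i(B) = ∑ ε(h) B_{bar h} B_h` of the moment map, the sum being over the arrows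
`h` with source `i`, with `ε(h) = 1` on `Ω` and `ε(h) = -1` elsewhere. (If only finitely many
`V_k` are nonzero, only finitely many terms are nonzero.) -/
noncomputable def momentMap (B : Rep Q V) (i : I) : Module.End ℂ (V i) :=
  open Classical in
  ∑ᶠ h : (Σ j, Q.Arr i j),
    (if h.2 ∈ Q.Ω then (1 : ℂ) else -1) • (B h.1 i (Q.bar h.2) ∘ₗ B i h.1 h.2)

variable {Q V} in
/-- There is a complete flag `0 = F₀ ⊂ F₁ ⊂ ⋯ ⊂ F_N = V` of graded subspaces (a maximal chain, so
that each step has dimension one) such that `B_h F_k ⊆ F_k` for the loops `h` outside `Ω`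
and `B_h F_{k+1} ⊆ F_k` for all other arrows `h`. -/
def HasAdaptedFlag (B : Rep Q V) : Prop :=
  ∃ (N : ℕ) (F : ℕ → ∀ j : I, Submodule ℂ (V j)),
    F 0 = ⊥ ∧ F N = ⊤ ∧ (∀ k < N, F k ⋖ F (k + 1)) ∧
    (∀ (a : I) (h : Q.Arr a a), h ∉ Q.Ω → ∀ k ≤ N, (F k a).map (B a a h) ≤ F k a) ∧
    (∀ (a b : I) (h : Q.Arr a b), ¬ (a = b ∧ h ∉ Q.Ω) →
      ∀ k < N, (F (k + 1) a).map (B a b h) ≤ F k b)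

/-- An endomorphism is regular semisimple if its eigenvalues are pairwise distinct, that is, if
its characteristic polynomial has no multiple root. -/
def IsRegularSemisimple {W : Type*} [AddCommGroup W] [Module ℂ W] [FiniteDimensional ℂ W]
    (T : Module.End ℂ W) : Prop :=
  (LinearMap.charpoly T).Separable

/-- The variety `𝒩` of the graded space `V`. -/
def nilVariety [∀ k, FiniteDimensional ℂ (V k)] : Set (Rep Q V) :=
  {B | HasAdaptedFlag B ∧ (∀ i, momentMap B i = 0) ∧
    ∀ (a : I) (h : Q.Arr a a), h ∉ Q.Ω → IsRegularSemisimple (B a a h)}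

variable {Q V} in
/-- The subalgebra of `End(V_i)` generated by the loops at `i`. -/
def loopAlgebra (B : Rep Q V) (i : I) : Subalgebra ℂ (Module.End ℂ (V i)) :=
  Algebra.adjoin ℂ (Set.range (B i i))

variable {Q V} in
/-- The subspace of `V_i` generated, under the loops at `i`, by the images of the arrows into `i`
that are not loops. -/
def generatedAt (B : Rep Q V) (i : I) : Submodule ℂ (V i) :=
  ⨆ T ∈ loopAlgebra B i,
    (⨆ (j : I) (_ : j ≠ i) (h : Q.Arr j i), LinearMap.range (B j i h)).map T

variable {Q V} in
/-- The number `ε_i(B)`: the codimension of `generatedAt B i` in `V_i`. -/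
noncomputable def eps (B : Rep Q V) (i : I) : ℕ :=
  Module.finrank ℂ (V i ⧸ generatedAt B i)

/-- The stratum of `𝒩` where `ε_i = n`. -/
def nilStratum [∀ k, FiniteDimensional ℂ (V k)] (n : ℕ) (i : I) : Set (Rep Q V) :=
  {B | B ∈ nilVariety Q V ∧ eps B i = n}

end Nilpotent

section Extensions

variable {I : Type u} (Q : DoubleQuiver.{u, v} I)
  (V : I → Type w) (V' : I → Type w') (V'' : I → Type w'')
  [∀ k, AddCommGroup (V k)] [∀ k, Module ℂ (V k)]
  [∀ k, AddCommGroup (V' k)] [∀ k, Module ℂ (V' k)]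
  [∀ k, AddCommGroup (V'' k)] [∀ k, Module ℂ (V'' k)]

/-- The vector space of all tuples `(B, B', B'', φ, φ')`, with `φ : V' → V` and `φ' : V → V''`. -/
abbrev ExtSpace : Type _ :=
  Rep Q V × Rep Q V' × Rep Q V'' × GradedHom V' V × GradedHom V V''

/-- The variety of short exact sequences `0 → V' → V → V'' → 0` of graded spaces. -/
def sesVariety : Set (GradedHom V' V × GradedHom V V'') :=
  {f | ∀ k, Function.Injective (f.1 k) ∧ Function.Exact (f.1 k) (f.2 k) ∧
    Function.Surjective (f.2 k)}

/-- The variety of extensions. -/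
def extVariety [∀ k, FiniteDimensional ℂ (V k)] [∀ k, FiniteDimensional ℂ (V' k)]
    [∀ k, FiniteDimensional ℂ (V'' k)] : Set (ExtSpace Q V V' V'') :=
  {x | match x with
    | (B, B', B'', φ, φ') =>
      B' ∈ nilVariety Q V' ∧ B'' ∈ nilVariety Q V'' ∧ B ∈ nilVariety Q V ∧
      (φ, φ') ∈ sesVariety V V' V'' ∧
      (∀ (a b : I) (h : Q.Arr a b), φ b ∘ₗ B' a b h = B a b h ∘ₗ φ a) ∧
      (∀ (a b : I) (h : Q.Arr a b), φ' b ∘ₗ B a b h = B'' a b h ∘ₗ φ' a)}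

variable {Q V V' V''}

/-- The map `(B, B', B'', φ, φ') ↦ B`. -/
def qMap (x : ExtSpace Q V V' V'') : Rep Q V := x.1

/-- The map `(B, B', B'', φ, φ') ↦ (B', B'')`. -/
def pMap (x : ExtSpace Q V V' V'') : Rep Q V' × Rep Q V'' := (x.2.1, x.2.2.1)

/-- The map `(B, B', B'', φ, φ') ↦ ((B', B''), (φ, φ'))`. -/
def pMap' (x : ExtSpace Q V V' V'') :
    (Rep Q V' × Rep Q V'') × (GradedHom V' V × GradedHom V V'') :=
  ((x.2.1, x.2.2.1), x.2.2.2)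

/-- The action of `GL(V') × GL(V'')` (the units of `End(V') × End(V'')`):
`(g, g') (B, B', B'', φ, φ') = (B, g B' g⁻¹, g' B'' g'⁻¹, φ g⁻¹, g' φ')`. -/
def gaugeAct (g : (GradedEnd V' × GradedEnd V'')ˣ) (x : ExtSpace Q V V' V'') :
    ExtSpace Q V V' V'' :=
  (x.1,
    fun a b h => g.val.1 b ∘ₗ x.2.1 a b h ∘ₗ g.inv.1 a,
    fun a b h => g.val.2 b ∘ₗ x.2.2.1 a b h ∘ₗ g.inv.2 a,
    fun k => x.2.2.2.1 k ∘ₗ g.inv.1 k,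
    fun k => g.val.2 k ∘ₗ x.2.2.2.2 k)

variable (Q V V' V'')

/-- The part of the variety of extensions that lies over the stratum `ε_i(B) = n`. -/
def extStratum [∀ k, FiniteDimensional ℂ (V k)] [∀ k, FiniteDimensional ℂ (V' k)]
    [∀ k, FiniteDimensional ℂ (V'' k)] (n : ℕ) (i : I) : Set (ExtSpace Q V V' V'') :=
  {x | x ∈ extVariety Q V V' V'' ∧ qMap x ∈ nilStratum Q V n i}

/-- The pairs `(B', B'')` in `𝒩_{n,i} × 𝒩` such that `B'_h` and `B''_h` have disjoint spectra for
every loop `h` at `i` outside `Ω`. -/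
def regProduct [∀ k, FiniteDimensional ℂ (V' k)] [∀ k, FiniteDimensional ℂ (V'' k)]
    (n : ℕ) (i : I) : Set (Rep Q V' × Rep Q V'') :=
  {x | x.1 ∈ nilStratum Q V' n i ∧ x.2 ∈ nilVariety Q V'' ∧
    ∀ h : Q.Arr i i, h ∉ Q.Ω →
      Disjoint (spectrum ℂ (x.1 i i h : Module.End ℂ (V' i)))
        (spectrum ℂ (x.2 i i h : Module.End ℂ (V'' i)))}

end Extensions

end LoopQuiver

open LoopQuiver

namespace LoopQuiver

universe u v w w' w''

/-! ## Regular functions and regular maps -/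

section Regular

variable {E F D G : Type*} [AddCommGroup E] [Module ℂ E] [AddCommGroup F] [Module ℂ F]
  [AddCommGroup D] [Module ℂ D] [AddCommGroup G] [Module ℂ G] {S T : Set E}

/-! Everything rests on `V''` being concentrated at the vertex `i`. In an extension, `φ` is then
bijective away from `i`, so `φ i` carries `generatedAt B' i` onto `generatedAt B i`
(`Intertwines.map_generatedAt`).

(a) The equality `eps B i = l = dim V''_i` and a dimension count force the image of `φ i` to be
`generatedAt B i`. Over a fixed `B`, a point is therefore an exact sequence with prescribed image,
since `B'` and `B''` are determined by the rest (`extVariety_ext`); two such sequences differ by a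
unique element of the group. For a local section near `B₀`, choose finitely many words in the loops,
applied to vectors in images of other arrows, that give a basis of `generatedAt B₀ i`. The same
words evaluated at `B` define a regular `φ(B)` with image inside `generatedAt B i`
(`exists_regular_embedding`). Where `ψ₀ ∘ φ(B)` is invertible, this is an embedding onto that
subspace, with a regular splitting (`IsSplitting.of_embedding`). Moving the section by the group
trivializes `q`.

(b) After splitting the sequence, `B` is block triangular with diagonal blocks `B'`, `B''` and a
free block `C`. Flags concatenate, characteristic polynomials multiply, and `eps B i = l` is
equivalent to `eps B' i = 0`. The only remaining condition is the moment map equation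
(`mem_extStratum_iff_regProduct`), whose off-diagonal block is a linear map `extMoment` of `C`. It
is surjective exactly because `B'` is generated at `i` (`extMoment_surjective`): the vectors
invisible to a functional that kills its range contain the images of the arrows into `i` and are
stable under the loops. The fibres of `p'` are thus affine spaces over the kernel of a surjection
depending regularly on the base point. Projection along the image of a fixed right inverse
(`kerProj`) identifies nearby kernels, and the rank is a difference of two dimensions. -/

theorem dual_mem_polyFun (c : Module.Dual ℂ E) : (c : E → ℂ) ∈ polyFun E :=
  Algebra.subset_adjoin ⟨c, rfl⟩

namespace IsRegularFunOn

theorem of_polyFun {a : E → ℂ} (ha : a ∈ polyFun E) : IsRegularFunOn S a := fun x _ =>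
  ⟨a, ha, 1, one_mem _, by simp, by simp⟩

theorem const (c : ℂ) : IsRegularFunOn S fun _ => c :=
  of_polyFun ((polyFun E).algebraMap_mem c)

theorem congr {f g : E → ℂ} (hf : IsRegularFunOn S f) (h : ∀ x ∈ S, f x = g x) :
    IsRegularFunOn S g := fun x hx => by
  obtain ⟨a, ha, b, hb, hbx, hab⟩ := hf x hx
  exact ⟨a, ha, b, hb, hbx, fun y hy hby => by rw [← h y hy, hab y hy hby]⟩

theorem mono {f : E → ℂ} (hf : IsRegularFunOn S f) (h : T ⊆ S) : IsRegularFunOn T f :=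
  fun x hx => by
    obtain ⟨a, ha, b, hb, hbx, hab⟩ := hf x (h hx)
    exact ⟨a, ha, b, hb, hbx, fun y hy hby => hab y (h hy) hby⟩

theorem add {f g : E → ℂ} (hf : IsRegularFunOn S f) (hg : IsRegularFunOn S g) :
    IsRegularFunOn S fun x => f x + g x := fun x hx => by
  obtain ⟨a, ha, b, hb, hbx, hab⟩ := hf x hx
  obtain ⟨a', ha', b', hb', hbx', hab'⟩ := hg x hx
  refine ⟨a * b' + b * a', add_mem (mul_mem ha hb') (mul_mem hb ha'), b * b', mul_mem hb hb',
    by simp [hbx, hbx'], fun y hy hby => ?_⟩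
  simp only [Pi.mul_apply, ne_eq, mul_eq_zero, not_or] at hby
  simp only [hab y hy hby.1, hab' y hy hby.2, Pi.add_apply, Pi.mul_apply]
  rw [div_add_div _ _ hby.1 hby.2]

theorem mul {f g : E → ℂ} (hf : IsRegularFunOn S f) (hg : IsRegularFunOn S g) :
    IsRegularFunOn S fun x => f x * g x := fun x hx => by
  obtain ⟨a, ha, b, hb, hbx, hab⟩ := hf x hx
  obtain ⟨a', ha', b', hb', hbx', hab'⟩ := hg x hx
  refine ⟨a * a', mul_mem ha ha', b * b', mul_mem hb hb', by simp [hbx, hbx'],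
    fun y hy hby => ?_⟩
  simp only [Pi.mul_apply, ne_eq, mul_eq_zero, not_or] at hby
  simp only [hab y hy hby.1, hab' y hy hby.2, Pi.mul_apply]
  rw [div_mul_div_comm]

theorem inv {f : E → ℂ} (hf : IsRegularFunOn S f) (h0 : ∀ x ∈ S, f x ≠ 0) :
    IsRegularFunOn S fun x => (f x)⁻¹ := fun x hx => by
  obtain ⟨a, ha, b, hb, hbx, hab⟩ := hf x hx
  have hax : a x ≠ 0 := fun h => h0 x hx (by simp [hab x hx hbx, h])
  -- The inverse of `a / b` is `b / a`; the common extra factor `b` makes the new denominator vanish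
  -- wherever the original fraction is unavailable.
  refine ⟨b * b, mul_mem hb hb, a * b, mul_mem ha hb, by simp [hax, hbx], fun y hy hby => ?_⟩
  simp only [Pi.mul_apply, ne_eq, mul_eq_zero, not_or] at hby
  simp only [hab y hy hby.2, Pi.mul_apply]
  rw [inv_div, mul_div_mul_right _ _ hby.2]

theorem sum {ι : Type*} (s : Finset ι) {f : ι → E → ℂ} (hf : ∀ i ∈ s, IsRegularFunOn S (f i)) :
    IsRegularFunOn S fun x => ∑ i ∈ s, f i x := by
  classical
  induction s using Finset.induction_on with
  | empty => simpa using const 0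
  | insert a s ha ih =>
    simp only [Finset.sum_insert ha]
    exact (hf a (by simp)).add (ih fun i hi => hf i (by simp [hi]))

theorem prod {ι : Type*} (s : Finset ι) {f : ι → E → ℂ} (hf : ∀ i ∈ s, IsRegularFunOn S (f i)) :
    IsRegularFunOn S fun x => ∏ i ∈ s, f i x := by
  classical
  induction s using Finset.induction_on with
  | empty => simpa using const 1
  | insert a s ha ih =>
    simp only [Finset.prod_insert ha]
    exact (hf a (by simp)).mul (ih fun i hi => hf i (by simp [hi]))

theorem det {ι : Type*} [Fintype ι] [DecidableEq ι] {M : E → Matrix ι ι ℂ}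
    (hM : ∀ i j, IsRegularFunOn S fun x => M x i j) : IsRegularFunOn S fun x => (M x).det := by
  simp only [Matrix.det_apply']
  exact sum _ fun σ _ => (const _).mul (prod _ fun i _ => hM _ _)

theorem matrix_inv {ι : Type*} [Fintype ι] [DecidableEq ι] {M : E → Matrix ι ι ℂ}
    (hM : ∀ i j, IsRegularFunOn S fun x => M x i j) (h0 : ∀ x ∈ S, (M x).det ≠ 0) (i j : ι) :
    IsRegularFunOn S fun x => (M x)⁻¹ i j := by
  simp only [Matrix.inv_def, Matrix.smul_apply, Matrix.adjugate_apply, Ring.inverse_eq_inv',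
    smul_eq_mul]
  refine ((det hM).inv h0).mul (det fun a b => ?_)
  by_cases h : a = j
  · subst h; simpa using const _
  · simpa [Matrix.updateRow_ne h] using hM a b

end IsRegularFunOn

/-- A regular function defines Zariski open non-vanishing loci. -/
theorem IsRegularFunOn.isZariskiOpenIn {f : E → ℂ} (hf : IsRegularFunOn S f) :
    IsZariskiOpenIn S {x | x ∈ S ∧ f x ≠ 0} := by
  choose! a ha b hb hbx hab using hf
  -- The product `a x * b x` is nonzero exactly where the local fraction at `x` is both valid and
  -- nonzero.
  refine ⟨{g | ∃ x ∈ S, g = a x * b x}, ?_, ?_⟩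
  · rintro _ ⟨x, hx, rfl⟩
    exact mul_mem (ha x hx) (hb x hx)
  · ext y
    simp only [Set.mem_ofPred_eq, and_congr_right_iff]
    intro hy
    constructor
    · intro h
      refine ⟨_, ⟨y, hy, rfl⟩, mul_ne_zero (fun h0 => h ?_) (hbx y hy)⟩
      rw [hab y hy y hy (hbx y hy), h0, zero_div]
    · rintro ⟨_, ⟨x, hx, rfl⟩, h⟩
      simp only [Pi.mul_apply, ne_eq, mul_eq_zero, not_or] at h
      rw [hab x hx y hy h.2]
      exact div_ne_zero h.1 h.2

/-- Regularity can be checked on a family of linear forms that separates the points. -/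
theorem IsRegularOn.of_separating [Module.Finite ℂ F] {f : E → F} {ι : Sort*}
    (c : ι → Module.Dual ℂ F) (hc : ∀ y, (∀ j, c j y = 0) → y = 0)
    (hf : ∀ j, IsRegularFunOn S fun x => c j (f x)) : IsRegularOn S f := by
  -- A separating family has zero coannihilator, so by finite-dimensional duality it spans the dual.
  have htop : Submodule.span ℂ (Set.range c) = ⊤ := by
    rw [← Subspace.dualCoannihilator_dualAnnihilator_eq (W := Submodule.span ℂ (Set.range c))]
    have : (Submodule.span ℂ (Set.range c)).dualCoannihilator = ⊥ := by
      rw [eq_bot_iff]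
      intro y hy
      rw [Submodule.mem_dualCoannihilator] at hy
      exact hc y fun j => hy _ (Submodule.subset_span ⟨j, rfl⟩)
    rw [this, Submodule.dualAnnihilator_bot]
  intro d
  have hd : d ∈ Submodule.span ℂ (Set.range c) := htop ▸ Submodule.mem_top
  induction hd using Submodule.span_induction with
  | mem x h => obtain ⟨j, rfl⟩ := h; exact hf j
  | zero => exact IsRegularFunOn.const 0
  | add x y _ _ hx hy => exact hx.add hy
  | smul a x _ hx => exact (IsRegularFunOn.const a).mul hx

namespace IsRegularOn

theorem linear (f : E →ₗ[ℂ] F) : IsRegularOn S f := fun c =>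
  IsRegularFunOn.of_polyFun (dual_mem_polyFun (c ∘ₗ f))

theorem const (y : F) : IsRegularOn S fun _ => y := fun c => IsRegularFunOn.const (c y)

theorem congr {f g : E → F} (hf : IsRegularOn S f) (h : ∀ x ∈ S, f x = g x) : IsRegularOn S g :=
  fun c => (hf c).congr fun x hx => by rw [h x hx]

theorem mono {f : E → F} (hf : IsRegularOn S f) (h : T ⊆ S) : IsRegularOn T f :=
  fun c => (hf c).mono h

theorem add {f g : E → F} (hf : IsRegularOn S f) (hg : IsRegularOn S g) :
    IsRegularOn S fun x => f x + g x := fun c => by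
  simpa using (hf c).add (hg c)

theorem linear_comp (L : F →ₗ[ℂ] D) {f : E → F} (hf : IsRegularOn S f) :
    IsRegularOn S fun x => L (f x) := fun c => hf (c ∘ₗ L)

theorem smul {f : E → ℂ} {g : E → F} (hf : IsRegularFunOn S f) (hg : IsRegularOn S g) :
    IsRegularOn S fun x => f x • g x := fun c => by
  simpa using hf.mul (hg c)

theorem sub {f g : E → F} (hf : IsRegularOn S f) (hg : IsRegularOn S g) :
    IsRegularOn S fun x => f x - g x := by
  simpa [sub_eq_add_neg] using hf.add (hg.linear_comp (-LinearMap.id))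

theorem sum {ι : Type*} (s : Finset ι) {f : ι → E → F} (hf : ∀ i ∈ s, IsRegularOn S (f i)) :
    IsRegularOn S fun x => ∑ i ∈ s, f i x := fun c => by
  simpa using IsRegularFunOn.sum s fun i hi => hf i hi c

theorem bilinear [Module.Finite ℂ F] (L : F →ₗ[ℂ] D →ₗ[ℂ] G) {f : E → F} {g : E → D}
    (hf : IsRegularOn S f) (hg : IsRegularOn S g) : IsRegularOn S fun x => L (f x) (g x) := by
  have key : ∀ x, L (f x) (g x) =
      ∑ j, (Module.finBasis ℂ F).coord j (f x) • L (Module.finBasis ℂ F j) (g x) := fun x => by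
    conv_lhs => rw [← (Module.finBasis ℂ F).sum_repr (f x)]
    simp [-Module.Basis.sum_repr]
  simp only [key]
  exact sum _ fun j _ => smul (hf _) (hg.linear_comp _)

theorem prodMk [Module.Finite ℂ F] [Module.Finite ℂ D] {f : E → F} {g : E → D}
    (hf : IsRegularOn S f) (hg : IsRegularOn S g) : IsRegularOn S fun x => (f x, g x) := by
  have := (hf.linear_comp (LinearMap.inl ℂ F D)).add (hg.linear_comp (LinearMap.inr ℂ F D))
  simpa using this

theorem pi {ι : Type*} {M : ι → Type*} [∀ j, AddCommGroup (M j)] [∀ j, Module ℂ (M j)]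
    [Module.Finite ℂ (∀ j, M j)] {f : E → ∀ j, M j}
    (hf : ∀ j, IsRegularOn S fun x => f x j) : IsRegularOn S f := by
  refine of_separating (ι := Σ j, Module.Dual ℂ (M j)) (fun c => c.2 ∘ₗ LinearMap.proj c.1)
    (fun y hy => ?_) fun c => hf c.1 c.2
  funext j
  exact (Module.forall_dual_apply_eq_zero_iff ℂ (y j)).1 fun c => hy ⟨j, c⟩

theorem hom [Module.Finite ℂ F] [Module.Finite ℂ D] {f : E → F →ₗ[ℂ] D}
    (hf : ∀ v, IsRegularOn S fun x => f x v) : IsRegularOn S f := by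
  refine of_separating (ι := F × Module.Dual ℂ D) (fun c => c.2 ∘ₗ LinearMap.applyₗ c.1)
    (fun y hy => ?_) fun c => hf c.1 c.2
  ext v
  exact (Module.forall_dual_apply_eq_zero_iff ℂ (y v)).1 fun c => hy ⟨v, c⟩

theorem apply {f : E → F →ₗ[ℂ] D} (hf : IsRegularOn S f) (v : F) : IsRegularOn S fun x => f x v :=
  hf.linear_comp (LinearMap.applyₗ v)

theorem proj {ι : Type*} {M : ι → Type*} [∀ j, AddCommGroup (M j)] [∀ j, Module ℂ (M j)]
    {f : E → ∀ j, M j} (hf : IsRegularOn S f) (j : ι) : IsRegularOn S fun x => f x j :=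
  hf.linear_comp (LinearMap.proj j)

theorem fst {f : E → F × D} (hf : IsRegularOn S f) : IsRegularOn S fun x => (f x).1 :=
  hf.linear_comp (LinearMap.fst ℂ F D)

theorem snd {f : E → F × D} (hf : IsRegularOn S f) : IsRegularOn S fun x => (f x).2 :=
  hf.linear_comp (LinearMap.snd ℂ F D)

theorem id : IsRegularOn S fun x => x := linear LinearMap.id

theorem comp_hom [Module.Finite ℂ F] [Module.Finite ℂ D] [Module.Finite ℂ G]
    {f : E → D →ₗ[ℂ] G} {g : E → F →ₗ[ℂ] D}
    (hf : IsRegularOn S f) (hg : IsRegularOn S g) : IsRegularOn S fun x => f x ∘ₗ g x :=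
  bilinear (LinearMap.llcomp ℂ F D G) hf hg

theorem polyFun_comp {f : E → F} (hf : IsRegularOn S f) {a : F → ℂ} (ha : a ∈ polyFun F) :
    IsRegularFunOn S fun x => a (f x) := by
  induction ha using Algebra.adjoin_induction with
  | mem x h => obtain ⟨c, rfl⟩ := h; exact hf c
  | algebraMap r => exact IsRegularFunOn.const r
  | add x y _ _ hx hy => exact hx.add hy
  | mul x y _ _ hx hy => exact hx.mul hy

theorem comp {U : Set F} {g : F → D} {f : E → F} (hg : IsRegularOn U g) (hf : IsRegularOn S f)
    (h : Set.MapsTo f S U) : IsRegularOn S fun x => g (f x) := fun c x hx => by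
  obtain ⟨a, ha, b, hb, hbx, hab⟩ := hg c (f x) (h hx)
  obtain ⟨a₁, ha₁, b₁, hb₁, hbx₁, hab₁⟩ := hf.polyFun_comp ha x hx
  obtain ⟨a₂, ha₂, b₂, hb₂, hbx₂, hab₂⟩ := hf.polyFun_comp hb x hx
  have ha₂x : a₂ x ≠ 0 := fun h0 => hbx ((hab₂ x hx hbx₂).trans (by rw [h0, zero_div]))
  -- With `a ∘ f = a₁ / b₁` and `b ∘ f = a₂ / b₂`, the composite is `a₁ b₂ / (b₁ a₂)`. The extra
  -- `b₂` on both sides ensures that the second fraction is valid wherever the new denominator is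
  -- nonzero.
  refine ⟨a₁ * b₂ * b₂, mul_mem (mul_mem ha₁ hb₂) hb₂, b₁ * a₂ * b₂, mul_mem (mul_mem hb₁ ha₂) hb₂,
    by simp [hbx₁, ha₂x, hbx₂], fun y hy hby => ?_⟩
  simp only [Pi.mul_apply, ne_eq, mul_eq_zero, not_or] at hby
  obtain ⟨⟨h1, h2⟩, h3⟩ := hby
  have hby : b (f y) ≠ 0 := (hab₂ y hy h3).trans_ne (div_ne_zero h2 h3)
  have e := hab (f y) (h hy) hby
  rw [show a (f y) = _ from hab₁ y hy h1, show b (f y) = _ from hab₂ y hy h3] at e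
  simp only [e, Pi.mul_apply]
  field_simp

end IsRegularOn

/-! ### Invertible elements of a finite-dimensional algebra. -/

section Units

variable {A : Type*} [Ring A] [Algebra ℂ A] [Module.Finite ℂ A]

/-- If left multiplication by `a` is bijective, it yields `b` with `a * b = 1`, and injectivity
applied to `a * (b * a) = a` makes `b` two-sided. Invertibility thus becomes the non-vanishing of
one polynomial. -/
theorem isUnit_iff_det_leftMulMatrix_ne_zero (a : A) :
    IsUnit a ↔ (Algebra.leftMulMatrix (Module.finBasis ℂ A) a).det ≠ 0 := by
  rw [← isUnit_iff_ne_zero, ← Matrix.isUnit_iff_isUnit_det]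
  constructor
  · exact fun h => h.map _
  · intro h
    have h1 : IsUnit (Algebra.lmul ℂ A a) := by
      rw [Algebra.leftMulMatrix_apply] at h
      exact (LinearMap.isUnit_toMatrix_iff (Module.finBasis ℂ A)).1 h
    have h2 := ((Module.End.isUnit_iff _).1 h1)
    obtain ⟨b, hb⟩ := h2.2 1
    have hb : a * b = 1 := hb
    refine ⟨⟨a, b, hb, h2.1 ?_⟩, rfl⟩
    change a * (b * a) = a * 1
    rw [← mul_assoc, hb, one_mul, mul_one]

theorem IsRegularOn.isRegularFunOn_det {f : E → A} (hf : IsRegularOn S f) :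
    IsRegularFunOn S fun x => (Algebra.leftMulMatrix (Module.finBasis ℂ A) (f x)).det := by
  refine IsRegularFunOn.det fun j k => ?_
  simp only [Algebra.leftMulMatrix_eq_repr_mul]
  exact hf ((Module.finBasis ℂ A).coord j ∘ₗ LinearMap.mulRight ℂ (Module.finBasis ℂ A k))

theorem IsRegularOn.isZariskiOpenIn_isUnit {f : E → A} (hf : IsRegularOn S f) :
    IsZariskiOpenIn S {x | x ∈ S ∧ IsUnit (f x)} := by
  simp only [isUnit_iff_det_leftMulMatrix_ne_zero]
  exact hf.isRegularFunOn_det.isZariskiOpenIn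

/-- The coordinates of the inverse solve the linear system with matrix `leftMulMatrix` and
right-hand side the coordinates of `1`, so Cramer's rule applies. -/
theorem IsRegularOn.ringInverse {f : E → A} (hf : IsRegularOn S f) (hu : ∀ x ∈ S, IsUnit (f x)) :
    IsRegularOn S fun x => Ring.inverse (f x) := by
  set b := Module.finBasis ℂ A
  have key : ∀ x ∈ S, ∑ j, (∑ k, (Algebra.leftMulMatrix b (f x))⁻¹ j k * b.repr 1 k) • b j =
      Ring.inverse (f x) := fun x hx => by
    have h1 : f x * Ring.inverse (f x) = 1 := Ring.mul_inverse_cancel _ (hu x hx)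
    have h2 : (Algebra.leftMulMatrix b (f x))⁻¹.mulVec (b.repr (f x * Ring.inverse (f x))) =
      (Algebra.leftMulMatrix b (f x))⁻¹.mulVec (b.repr 1) := by rw [h1]
    rw [← Algebra.leftMulMatrix_mulVec_repr, Matrix.mulVec_mulVec, Matrix.nonsing_inv_mul _
      ((isUnit_iff_det_leftMulMatrix_ne_zero _).1 (hu x hx)).isUnit, Matrix.one_mulVec] at h2
    conv_rhs => rw [← b.sum_repr (Ring.inverse (f x)), h2]
    rfl
  have hM : ∀ j k, IsRegularFunOn S fun x => Algebra.leftMulMatrix b (f x) j k := fun j k => by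
    simp only [Algebra.leftMulMatrix_eq_repr_mul]
    exact hf (b.coord j ∘ₗ LinearMap.mulRight ℂ (b k))
  have hI := IsRegularFunOn.matrix_inv hM
    fun x hx => (isUnit_iff_det_leftMulMatrix_ne_zero _).1 (hu x hx)
  exact congr (sum _ fun j _ => smul (IsRegularFunOn.sum _ fun k _ =>
    (hI j k).mul (IsRegularFunOn.const _)) (const _)) key

end Units

end Regular

/-! ## Split short exact sequences -/

section Splitting

variable {V V' V'' : Type*} [AddCommGroup V] [Module ℂ V] [AddCommGroup V'] [Module ℂ V']
  [AddCommGroup V''] [Module ℂ V'']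

/-- `ψ` and `s` split the sequence given by `φ` and `φ'`. -/
structure IsSplitting (φ : V' →ₗ[ℂ] V) (φ' : V →ₗ[ℂ] V'') (ψ : V →ₗ[ℂ] V') (s : V'' →ₗ[ℂ] V) :
    Prop where
  retraction : ∀ x, ψ (φ x) = x
  cosection : ∀ y, φ' (s y) = y
  sum : ∀ v, φ (ψ v) + s (φ' v) = v

namespace IsSplitting

variable {φ : V' →ₗ[ℂ] V} {φ' : V →ₗ[ℂ] V''} {ψ : V →ₗ[ℂ] V'} {s : V'' →ₗ[ℂ] V}

theorem comp_eq_zero (h : IsSplitting φ φ' ψ s) (x : V') : φ' (φ x) = 0 := by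
  have h1 := h.sum (φ x)
  rw [h.retraction, add_eq_left] at h1
  rw [← h.cosection (φ' (φ x)), h1, map_zero]

theorem retraction_section (h : IsSplitting φ φ' ψ s) (y : V'') : ψ (s y) = 0 := by
  have h1 := h.sum (s y)
  rw [h.cosection, add_eq_right] at h1
  rw [← h.retraction (ψ (s y)), h1, map_zero]

theorem injective (h : IsSplitting φ φ' ψ s) : Function.Injective φ :=
  Function.LeftInverse.injective h.retraction

theorem surjective (h : IsSplitting φ φ' ψ s) : Function.Surjective φ' :=
  Function.RightInverse.surjective h.cosection

theorem exact (h : IsSplitting φ φ' ψ s) : Function.Exact φ φ' := fun v => by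
  constructor
  · intro hv
    exact ⟨ψ v, by simpa [hv] using h.sum v⟩
  · rintro ⟨x, rfl⟩
    exact h.comp_eq_zero x

/-- The isomorphism of the middle term with the direct sum. -/
noncomputable def equivProd (h : IsSplitting φ φ' ψ s) : V ≃ₗ[ℂ] V' × V'' :=
  LinearEquiv.ofLinearMap (ψ.prod φ') (φ.coprod s)
    (by ext x <;> simp [h.retraction, h.cosection, h.comp_eq_zero, h.retraction_section])
    (by ext x; simp [h.sum])

theorem exists_of_exact (hφ : Function.Injective φ) (hex : Function.Exact φ φ')
    (hφ' : Function.Surjective φ') : ∃ ψ s, IsSplitting φ φ' ψ s := by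
  obtain ⟨ψ, hψ⟩ := φ.exists_leftInverse_of_injective (LinearMap.ker_eq_bot.2 hφ)
  obtain ⟨r, hr⟩ := φ'.exists_rightInverse_of_surjective (LinearMap.range_eq_top.2 hφ')
  have hψ : ∀ x, ψ (φ x) = x := LinearMap.congr_fun hψ
  have hr : ∀ x, φ' (r x) = x := LinearMap.congr_fun hr
  have h0 : ∀ x, φ' (φ x) = 0 := hex.apply_apply_eq_zero
  -- Subtracting its component along `φ` moves the section `r` into the kernel of `ψ`, as the
  -- decomposition of the identity requires.
  refine ⟨ψ, r - φ ∘ₗ ψ ∘ₗ r, hψ, fun y => by simp [hr, h0], fun v => ?_⟩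
  obtain ⟨x, hx⟩ := (hex (v - r (φ' v))).1 (by simp [hr])
  have h1 : φ (ψ (φ x)) = φ x := by rw [hψ]
  rw [hx, map_sub, map_sub] at h1
  simp only [LinearMap.sub_apply, LinearMap.comp_apply]
  rw [← sub_eq_zero] at h1 ⊢
  rw [← h1]
  abel

variable [FiniteDimensional ℂ V'] [FiniteDimensional ℂ V'']

theorem finrank_eq (h : IsSplitting φ φ' ψ s) :
    Module.finrank ℂ V = Module.finrank ℂ V' + Module.finrank ℂ V'' := by
  rw [h.equivProd.finrank_eq, Module.finrank_prod]

/-- In a basis adapted to the splitting, `T` is block upper triangular with diagonal blocks `T'` and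
`T''`. -/
theorem charpoly_eq [FiniteDimensional ℂ V] (h : IsSplitting φ φ' ψ s) {T : Module.End ℂ V} {T' : Module.End ℂ V'}
    {T'' : Module.End ℂ V''} (h' : φ ∘ₗ T' = T ∘ₗ φ) (h'' : φ' ∘ₗ T = T'' ∘ₗ φ') :
    T.charpoly = T'.charpoly * T''.charpoly := by
  have h' : ∀ x, T (φ x) = φ (T' x) := fun x => (LinearMap.congr_fun h' x).symm
  have h'' : ∀ x, φ' (T x) = T'' (φ' x) := LinearMap.congr_fun h''
  let b' := Module.finBasis ℂ V'
  let b'' := Module.finBasis ℂ V''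
  rw [← h.equivProd.charpoly_conj T, ← LinearMap.charpoly_toMatrix _ (b'.prod b''),
    ← LinearMap.charpoly_toMatrix T' b', ← LinearMap.charpoly_toMatrix T'' b'',
    ← Matrix.fromBlocks_toBlocks (LinearMap.toMatrix (b'.prod b'') (b'.prod b'') _)]
  have h21 : (LinearMap.toMatrix (b'.prod b'') (b'.prod b'') (h.equivProd.conj T)).toBlocks₂₁
      = 0 := by
    ext j k
    simp [Matrix.toBlocks₂₁, LinearMap.toMatrix_apply, equivProd, LinearEquiv.conj_apply, h',
      h.comp_eq_zero]
  have h11 : (LinearMap.toMatrix (b'.prod b'') (b'.prod b'') (h.equivProd.conj T)).toBlocks₁₁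
      = LinearMap.toMatrix b' b' T' := by
    ext j k
    simp [Matrix.toBlocks₁₁, LinearMap.toMatrix_apply, equivProd, LinearEquiv.conj_apply, h',
      h.retraction]
  have h22 : (LinearMap.toMatrix (b'.prod b'') (b'.prod b'') (h.equivProd.conj T)).toBlocks₂₂
      = LinearMap.toMatrix b'' b'' T'' := by
    ext j k
    simp [Matrix.toBlocks₂₂, LinearMap.toMatrix_apply, equivProd, LinearEquiv.conj_apply, h'',
      h.cosection]
  rw [h21, h11, h22, Matrix.charpoly_fromBlocks_zero₂₁]

end IsSplitting

end Splitting

/-- Over an algebraically closed field, coprime means without common root, and the roots of the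
characteristic polynomial are the eigenvalues. -/
theorem disjoint_spectrum_iff {V W : Type*} [AddCommGroup V] [Module ℂ V] [FiniteDimensional ℂ V]
    [AddCommGroup W] [Module ℂ W] [FiniteDimensional ℂ W] (T : Module.End ℂ V)
    (T' : Module.End ℂ W) :
    Disjoint (spectrum ℂ T) (spectrum ℂ T') ↔ IsCoprime T.charpoly T'.charpoly := by
  rw [Polynomial.isCoprime_iff_aeval_ne_zero_of_isAlgClosed ℂ ℂ, Set.disjoint_left]
  refine forall_congr' fun a => ?_
  rw [← Module.End.hasEigenvalue_iff_mem_spectrum, ← Module.End.hasEigenvalue_iff_mem_spectrum,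
    Module.End.hasEigenvalue_iff_isRoot_charpoly, Module.End.hasEigenvalue_iff_isRoot_charpoly]
  simp only [Polynomial.IsRoot.def, Polynomial.coe_aeval_eq_eval]
  tauto

/-! ## Representations -/

section Basic

variable {I : Type u} {Q : DoubleQuiver.{u, v} I} {V : I → Type w} {V' : I → Type w'}
  [∀ k, AddCommGroup (V k)] [∀ k, Module ℂ (V k)]
  [∀ k, AddCommGroup (V' k)] [∀ k, Module ℂ (V' k)]

/-- Graded maps that are compatible with the operators. -/
def Intertwines (φ : GradedHom V' V) (B' : Rep Q V') (B : Rep Q V) : Prop :=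
  ∀ (a b : I) (h : Q.Arr a b), φ b ∘ₗ B' a b h = B a b h ∘ₗ φ a

theorem Intertwines.apply {φ : GradedHom V' V} {B' : Rep Q V'} {B : Rep Q V}
    (H : Intertwines φ B' B) {a b : I} (h : Q.Arr a b) (x : V' a) :
    φ b (B' a b h x) = B a b h (φ a x) := LinearMap.congr_fun (H a b h) x

/-! ### Flags -/

/-- Images and preimages of a complete flag may stall at some steps. Deleting one repeated term
preserves all the conditions and shortens the chain, so induction on the length recovers a complete
flag. -/
theorem hasAdaptedFlag_of_wcovBy {B : Rep Q V} (N : ℕ) (F : ℕ → ∀ j : I, Submodule ℂ (V j))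
    (h0 : F 0 = ⊥) (hN : F N = ⊤) (hF : ∀ k < N, F k ⩿ F (k + 1))
    (hl : ∀ (a : I) (h : Q.Arr a a), h ∉ Q.Ω → ∀ k ≤ N, (F k a).map (B a a h) ≤ F k a)
    (hs : ∀ (a b : I) (h : Q.Arr a b), ¬ (a = b ∧ h ∉ Q.Ω) →
      ∀ k < N, (F (k + 1) a).map (B a b h) ≤ F k b) : HasAdaptedFlag B := by
  induction N generalizing F with
  | zero => exact ⟨0, F, h0, hN, by simp, hl, hs⟩
  | succ N ih =>
    by_cases hc : ∀ k < N + 1, F k ⋖ F (k + 1)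
    · exact ⟨N + 1, F, h0, hN, hc, hl, hs⟩
    push Not at hc
    obtain ⟨k, hk, hc⟩ := hc
    have he : F k = F (k + 1) := by
      rcases (hF k hk).covBy_or_eq with h | h
      · exact absurd h hc
      · exact h
    -- The new chain omits the index `k + 1`, where `F (k + 1)` repeats `F k`.
    refine ih (fun m => if m ≤ k then F m else F (m + 1)) (by simpa using h0) ?_ ?_ ?_ ?_
    · by_cases h : N ≤ k
      · obtain rfl : N = k := by omega
        simpa [he] using hN
      · simpa [h] using hN
    · intro m hm
      rcases lt_trichotomy m k with h | rfl | h
      · simpa [h.le, Nat.succ_le_of_lt h] using hF m (by omega)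
      · simpa [he] using hF (m + 1) (by omega)
      · simpa [h.not_ge, show ¬ m + 1 ≤ k by omega] using hF (m + 1) (by omega)
    · intro a h hh m hm
      by_cases h1 : m ≤ k
      · simpa [h1] using hl a h hh m (by omega)
      · simpa [h1] using hl a h hh (m + 1) (by omega)
    · intro a b h hh m hm
      rcases lt_trichotomy m k with h1 | rfl | h1
      · simpa [h1.le, Nat.succ_le_of_lt h1] using hs a b h hh m (by omega)
      · simpa [he] using hs a b h hh (m + 1) (by omega)
      · simpa [h1.not_ge, show ¬ m + 1 ≤ k by omega] using hs a b h hh (m + 1) (by omega)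

/-- A graded subspace `c` between the two preimages gives `φ(c) + a` between `a` and `b`; since `c`
contains the kernel of `φ`, it is recovered from this sum. -/
theorem wcovBy_comap (φ : GradedHom V' V) {a b : ∀ j, Submodule ℂ (V j)} (h : a ⩿ b) :
    (fun j => (a j).comap (φ j)) ⩿ fun j => (b j).comap (φ j) := by
  refine wcovBy_iff_le_and_eq_or_eq.2 ⟨fun j => Submodule.comap_mono (h.1 j), fun c h1 h2 => ?_⟩
  rcases h.eq_or_eq (c := fun j => (c j).map (φ j) ⊔ a j) (fun j => le_sup_right)
    (fun j => sup_le (Submodule.map_le_iff_le_comap.2 (h2 j)) (h.1 j)) with h3 | h3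
  · left
    refine le_antisymm (fun j => Submodule.map_le_iff_le_comap.1 ?_) h1
    have := congrFun h3 j
    exact le_sup_left.trans this.le
  · right
    refine le_antisymm h2 fun j x hx => ?_
    have hx : φ j x ∈ (c j).map (φ j) ⊔ a j := (congrFun h3 j).ge hx
    obtain ⟨_, ⟨y, hy, rfl⟩, z, hz, e⟩ := Submodule.mem_sup.1 hx
    have : x - y ∈ c j := h1 j (by simpa [← e] using hz)
    simpa using add_mem this hy

/-- Dually, `c` between the two images is tested by `φ⁻¹(c) ∩ b`. -/
theorem wcovBy_map (φ : GradedHom V' V) {a b : ∀ j, Submodule ℂ (V' j)} (h : a ⩿ b) :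
    (fun j => (a j).map (φ j)) ⩿ fun j => (b j).map (φ j) := by
  refine wcovBy_iff_le_and_eq_or_eq.2 ⟨fun j => Submodule.map_mono (h.1 j), fun c h1 h2 => ?_⟩
  rcases h.eq_or_eq (c := fun j => (c j).comap (φ j) ⊓ b j)
    (fun j => le_inf (Submodule.map_le_iff_le_comap.1 (h1 j)) (h.1 j)) (fun j => inf_le_right)
    with h3 | h3
  · left
    refine le_antisymm (fun j x hx => ?_) h1
    obtain ⟨y, hy, rfl⟩ := h2 j hx
    exact ⟨y, (congrFun h3 j).le ⟨hx, hy⟩, rfl⟩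
  · right
    refine le_antisymm h2 fun j => Submodule.map_le_iff_le_comap.2 ?_
    exact (congrFun h3 j).ge.trans inf_le_left

theorem HasAdaptedFlag.of_injective {φ : GradedHom V' V} {B' : Rep Q V'} {B : Rep Q V}
    (H : Intertwines φ B' B) (hφ : ∀ k, Function.Injective (φ k)) (hB : HasAdaptedFlag B) :
    HasAdaptedFlag B' := by
  obtain ⟨N, F, h0, hN, hF, hl, hs⟩ := hB
  refine hasAdaptedFlag_of_wcovBy N (fun k j => (F k j).comap (φ j)) ?_ ?_
    (fun k hk => wcovBy_comap φ (hF k hk).wcovBy) ?_ ?_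
  · funext j
    simpa [h0] using LinearMap.ker_eq_bot.2 (hφ j)
  · funext j
    simp [hN]
  · rintro a h hh k hk _ ⟨x, hx, rfl⟩
    change φ a _ ∈ F k a
    rw [H.apply]
    exact hl a h hh k hk ⟨_, hx, rfl⟩
  · rintro a b h hh k hk _ ⟨x, hx, rfl⟩
    change φ b _ ∈ F k b
    rw [H.apply]
    exact hs a b h hh k hk ⟨_, hx, rfl⟩

theorem HasAdaptedFlag.of_surjective {φ : GradedHom V' V} {B' : Rep Q V'} {B : Rep Q V}
    (H : Intertwines φ B' B) (hφ : ∀ k, Function.Surjective (φ k)) (hB : HasAdaptedFlag B') :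
    HasAdaptedFlag B := by
  obtain ⟨N, F, h0, hN, hF, hl, hs⟩ := hB
  refine hasAdaptedFlag_of_wcovBy N (fun k j => (F k j).map (φ j)) ?_ ?_
    (fun k hk => wcovBy_map φ (hF k hk).wcovBy) ?_ ?_
  · funext j
    simp [h0]
  · funext j
    simpa [hN] using LinearMap.range_eq_top.2 (hφ j)
  · rintro a h hh k hk _ ⟨_, ⟨x, hx, rfl⟩, rfl⟩
    rw [← H.apply]
    exact ⟨_, hl a h hh k hk ⟨_, hx, rfl⟩, rfl⟩
  · rintro a b h hh k hk _ ⟨_, ⟨x, hx, rfl⟩, rfl⟩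
    rw [← H.apply]
    exact ⟨_, hs a b h hh k hk ⟨_, hx, rfl⟩, rfl⟩

/-- The image of the flag of `V'` climbs to the range of `φ`, which is the kernel of `φ'`; the
preimage of the flag of `V''` continues from there. -/
theorem HasAdaptedFlag.extension {V'' : I → Type w''} [∀ k, AddCommGroup (V'' k)]
    [∀ k, Module ℂ (V'' k)] {φ : GradedHom V' V} {φ' : GradedHom V V''} {B' : Rep Q V'}
    {B : Rep Q V} {B'' : Rep Q V''} (H : Intertwines φ B' B) (H' : Intertwines φ' B B'')
    (hex : (φ, φ') ∈ sesVariety V V' V'') (hB' : HasAdaptedFlag B') (hB'' : HasAdaptedFlag B'') :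
    HasAdaptedFlag B := by
  obtain ⟨N, F, h0, hN, hF, hl, hs⟩ := hB'
  obtain ⟨N', F', h0', hN', hF', hl', hs'⟩ := hB''
  have hmid : ∀ j, (F N j).map (φ j) = (F' 0 j).comap (φ' j) := fun j => by
    simpa [hN, h0'] using (LinearMap.exact_iff.1 (hex j).2.1).symm
  -- The index `N` belongs to both halves. Reading it as part of the upper half handles the step
  -- from `N` to `N + 1`.
  have hG : ∀ m, N ≤ m → (fun j => if m ≤ N then (F m j).map (φ j)
      else (F' (m - N) j).comap (φ' j)) = fun j => (F' (m - N) j).comap (φ' j) := fun m hm => by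
    rcases hm.eq_or_lt with rfl | hm
    · simp [hmid]
    · simp [hm.not_ge]
  have stab : ∀ (a b : I) (h : Q.Arr a b) (k k' : ℕ),
      (F k a).map (B' a b h) ≤ F k' b → ((F k a).map (φ a)).map (B a b h) ≤ (F k' b).map (φ b) := by
    rintro a b h k k' hle _ ⟨_, ⟨x, hx, rfl⟩, rfl⟩
    rw [← H.apply]
    exact ⟨_, hle ⟨_, hx, rfl⟩, rfl⟩
  have stab' : ∀ (a b : I) (h : Q.Arr a b) (k k' : ℕ), (F' k a).map (B'' a b h) ≤ F' k' b →
      ((F' k a).comap (φ' a)).map (B a b h) ≤ (F' k' b).comap (φ' b) := by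
    rintro a b h k k' hle _ ⟨x, hx, rfl⟩
    change φ' b _ ∈ F' k' b
    rw [H'.apply]
    exact hle ⟨_, hx, rfl⟩
  refine hasAdaptedFlag_of_wcovBy (N + N') (fun m j => if m ≤ N then (F m j).map (φ j)
      else (F' (m - N) j).comap (φ' j)) ?_ ?_ ?_ ?_ ?_
  · funext j
    simp [h0]
  · rw [hG _ (by omega)]
    funext j
    simp [hN']
  · intro m hm
    by_cases h : m < N
    · simpa [h.le, Nat.succ_le_of_lt h] using wcovBy_map φ (hF m h).wcovBy
    · rw [hG _ (by omega), hG _ (by omega), show m + 1 - N = m - N + 1 by omega]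
      exact wcovBy_comap φ' (hF' (m - N) (by omega)).wcovBy
  · intro a h hh m hm
    by_cases h1 : m ≤ N
    · simpa [h1] using stab a a h m m (hl a h hh m h1)
    · simpa [h1] using stab' a a h _ _ (hl' a h hh (m - N) (by omega))
  · intro a b h hh m hm
    by_cases h1 : m < N
    · simpa [h1.le, Nat.succ_le_of_lt h1] using stab a b h (m + 1) m (hs a b h hh m h1)
    · have e1 := congrFun (hG m (by omega)) b
      have e2 := congrFun (hG (m + 1) (by omega)) a
      beta_reduce at e1 e2 ⊢
      rw [e1, e2, show m + 1 - N = m - N + 1 by omega]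
      exact stab' a b h _ _ (hs' a b h hh (m - N) (by omega))

/-! ### The moment map -/

/-- The sign of an arrow. -/
noncomputable def sgn {i j : I} (h : Q.Arr i j) : ℂ := open Classical in if h ∈ Q.Ω then 1 else -1

theorem sgn_ne_zero {i j : I} (h : Q.Arr i j) : sgn h ≠ 0 := by
  unfold sgn; split_ifs <;> simp

theorem finite_arrows (Q : DoubleQuiver.{u, v} I) (i : I) (S : Finset I) :
    {h : Σ j, Q.Arr i j | h.1 ∈ S}.Finite := by
  have := Q.finite_arr i
  refine (S.finite_toSet.biUnion fun j _ => Set.finite_range (Sigma.mk j)).subset ?_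
  rintro ⟨j, h⟩ hj
  exact Set.mem_biUnion hj ⟨h, rfl⟩

/-- The arrows from `i` to the elements of a finite set. -/
noncomputable def arrows (Q : DoubleQuiver.{u, v} I) (i : I) (S : Finset I) :
    Finset (Σ j, Q.Arr i j) := (finite_arrows Q i S).toFinset

theorem mem_arrows {i : I} {S : Finset I} {h : Σ j, Q.Arr i j} : h ∈ arrows Q i S ↔ h.1 ∈ S := by
  simp [arrows]

theorem momentMap_eq_sum {S : Finset I} (hS : ∀ k ∉ S, Subsingleton (V k)) (B : Rep Q V) (i : I) :
    momentMap B i = ∑ h ∈ arrows Q i S, sgn h.2 • (B h.1 i (Q.bar h.2) ∘ₗ B i h.1 h.2) := by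
  refine finsum_eq_sum_of_support_subset _ fun h hh => ?_
  rw [Finset.mem_coe, mem_arrows]
  by_contra hc
  have := hS _ hc
  refine hh ?_
  beta_reduce
  rw [Subsingleton.elim (B i h.1 h.2) 0, LinearMap.comp_zero, smul_zero]

theorem Intertwines.momentMap {S : Finset I} (hS : ∀ k ∉ S, Subsingleton (V k))
    (hS' : ∀ k ∉ S, Subsingleton (V' k)) {φ : GradedHom V' V} {B' : Rep Q V'} {B : Rep Q V}
    (H : Intertwines φ B' B) (i : I) (x : V' i) :
    φ i (momentMap B' i x) = LoopQuiver.momentMap B i (φ i x) := by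
  simp [momentMap_eq_sum hS, momentMap_eq_sum hS', LinearMap.sum_apply, H.apply]

/-! ### The subspace generated by the incoming arrows -/

/-- Minimality: the subspace is the smallest one that contains the images of the non-loop arrows and
is stable under the loops. Later bounds follow from this without handling the loop algebra. -/
theorem generatedAt_le {B : Rep Q V} {i : I} {N : Submodule ℂ (V i)}
    (hr : ∀ j, j ≠ i → ∀ h : Q.Arr j i, LinearMap.range (B j i h) ≤ N)
    (hl : ∀ h : Q.Arr i i, N.map (B i i h) ≤ N) : generatedAt B i ≤ N := by
  refine iSup₂_le fun T hT => (Submodule.map_mono (iSup₂_le fun j hj =>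
    iSup_le fun h => hr j hj h)).trans ?_
  refine Submodule.map_le_iff_le_comap.2 ?_
  induction hT using Algebra.adjoin_induction with
  | mem x h => obtain ⟨h, rfl⟩ := h; exact Submodule.map_le_iff_le_comap.1 (hl h)
  | algebraMap r => intro x hx; exact N.smul_mem r hx
  | add T T' _ _ h h' => intro x hx; exact N.add_mem (h hx) (h' hx)
  | mul T T' _ _ h h' => intro x hx; exact h (h' hx)

theorem map_loopAlgebra_le_generatedAt {B : Rep Q V} {i j : I} (hj : j ≠ i) (h : Q.Arr j i)
    {T : Module.End ℂ (V i)} (hT : T ∈ loopAlgebra B i) (v : V j) :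
    T (B j i h v) ∈ generatedAt B i :=
  Submodule.mem_iSup_of_mem T (Submodule.mem_iSup_of_mem hT ⟨_, Submodule.mem_iSup_of_mem j
    (Submodule.mem_iSup_of_mem hj (Submodule.mem_iSup_of_mem h ⟨v, rfl⟩)), rfl⟩)

theorem range_le_generatedAt (B : Rep Q V) {i j : I} (hj : j ≠ i) (h : Q.Arr j i) :
    LinearMap.range (B j i h) ≤ generatedAt B i := by
  rintro _ ⟨v, rfl⟩
  exact map_loopAlgebra_le_generatedAt hj h (one_mem _) v

theorem map_generatedAt_le (B : Rep Q V) {i : I} (h : Q.Arr i i) :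
    (generatedAt B i).map (B i i h) ≤ generatedAt B i := by
  rw [Submodule.map_le_iff_le_comap]
  refine iSup₂_le fun T hT => ?_
  rw [← Submodule.map_le_iff_le_comap, ← Submodule.map_comp]
  have : B i i h * T ∈ loopAlgebra B i := mul_mem (Algebra.subset_adjoin ⟨h, rfl⟩) hT
  exact le_iSup₂_of_le (f := fun T (_ : T ∈ loopAlgebra B i) => Submodule.map T _) _ this le_rfl

/-- Both inclusions follow from minimality. Surjectivity away from `i` is what lifts the images of
the non-loop arrows in `V` to `V'`. -/
theorem Intertwines.map_generatedAt {φ : GradedHom V' V} {B' : Rep Q V'} {B : Rep Q V}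
    (H : Intertwines φ B' B) {i : I} (hφ : ∀ j, j ≠ i → Function.Surjective (φ j)) :
    (generatedAt B' i).map (φ i) = generatedAt B i := by
  apply le_antisymm
  · rw [Submodule.map_le_iff_le_comap]
    refine generatedAt_le (fun j hj h => ?_) fun h => ?_
    · rintro _ ⟨x, rfl⟩
      change φ i _ ∈ generatedAt B i
      rw [H.apply]
      exact range_le_generatedAt B hj h ⟨_, rfl⟩
    · rintro _ ⟨x, hx, rfl⟩
      change φ i _ ∈ generatedAt B i
      rw [H.apply]
      exact map_generatedAt_le B h ⟨_, hx, rfl⟩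
  · refine generatedAt_le (fun j hj h => ?_) fun h => ?_
    · rintro _ ⟨x, rfl⟩
      obtain ⟨y, rfl⟩ := hφ j hj x
      rw [← H.apply]
      exact ⟨_, range_le_generatedAt B' hj h ⟨_, rfl⟩, rfl⟩
    · rintro _ ⟨_, ⟨x, hx, rfl⟩, rfl⟩
      rw [← H.apply]
      exact ⟨_, map_generatedAt_le B' h ⟨_, hx, rfl⟩, rfl⟩

theorem Intertwines.generatedAt_le_range {φ : GradedHom V' V} {B' : Rep Q V'} {B : Rep Q V}
    (H : Intertwines φ B' B) {i : I} (hφ : ∀ j, j ≠ i → Function.Surjective (φ j)) :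
    generatedAt B i ≤ LinearMap.range (φ i) := by
  rw [← H.map_generatedAt hφ]
  exact LinearMap.map_le_range

theorem finrank_generatedAt_add_eps [∀ k, FiniteDimensional ℂ (V k)] (B : Rep Q V) (i : I) :
    Module.finrank ℂ (generatedAt B i) + eps B i = Module.finrank ℂ (V i) := by
  rw [add_comm]
  exact Submodule.finrank_quotient_add_finrank _

theorem eps_eq_zero_iff [∀ k, FiniteDimensional ℂ (V k)] {B : Rep Q V} {i : I} :
    eps B i = 0 ↔ generatedAt B i = ⊤ := by
  rw [eps, Module.finrank_zero_iff, Submodule.Quotient.subsingleton_iff]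

end Basic

/-! ## Extensions -/

section Finite

variable {I : Type*} {S : Finset I}

/-- The vertex set may be infinite; support in `S` is what makes the ambient spaces
finite-dimensional, as the regularity lemmas require. -/
theorem finite_pi_of_subsingleton {M : I → Type*} [∀ k, AddCommGroup (M k)] [∀ k, Module ℂ (M k)]
    [∀ k, Module.Finite ℂ (M k)] (hS : ∀ k ∉ S, Subsingleton (M k)) :
    Module.Finite ℂ (∀ k, M k) := by
  refine Module.Finite.of_injective
    (LinearMap.pi fun k : S => LinearMap.proj k.1 : (∀ k, M k) →ₗ[ℂ] ∀ k : S, M k) fun f g h => ?_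
  funext k
  by_cases hk : k ∈ S
  · exact congrFun h ⟨k, hk⟩
  · exact (hS k hk).elim _ _

theorem finrank_pi_of_subsingleton {M : I → Type*} [∀ k, AddCommGroup (M k)]
    [∀ k, Module ℂ (M k)] [∀ k, Module.Finite ℂ (M k)] (hS : ∀ k ∉ S, Subsingleton (M k)) :
    Module.finrank ℂ (∀ k, M k) = ∑ k ∈ S, Module.finrank ℂ (M k) := by
  classical
  rw [← Finset.sum_coe_sort S fun k => Module.finrank ℂ (M k), ← Module.finrank_pi_fintype]
  refine LinearEquiv.finrank_eq (LinearEquiv.ofBijective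
    (LinearMap.pi fun k : S => LinearMap.proj k.1 : (∀ k, M k) →ₗ[ℂ] ∀ k : S, M k)
    ⟨fun f g h => ?_, fun f => ?_⟩)
  · funext k
    by_cases hk : k ∈ S
    · exact congrFun h ⟨k, hk⟩
    · exact (hS k hk).elim _ _
  · exact ⟨fun k => if hk : k ∈ S then f ⟨k, hk⟩ else 0, by ext k; simp⟩

variable {V : I → Type*} {V' : I → Type*}
  [∀ k, AddCommGroup (V k)] [∀ k, Module ℂ (V k)] [∀ k, FiniteDimensional ℂ (V k)]
  [∀ k, AddCommGroup (V' k)] [∀ k, Module ℂ (V' k)] [∀ k, FiniteDimensional ℂ (V' k)]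

theorem finite_gradedHom (hS : ∀ k ∉ S, Subsingleton (V k)) :
    Module.Finite ℂ (GradedHom V V') :=
  finite_pi_of_subsingleton (S := S) fun k hk => by have := hS k hk; infer_instance

/-- Families of linear maps `V_a → V'_b` indexed by the arrows `a → b`. -/
abbrev ArrowHom (Q : DoubleQuiver I) (V V' : I → Type*)
    [∀ k, AddCommGroup (V k)] [∀ k, Module ℂ (V k)]
    [∀ k, AddCommGroup (V' k)] [∀ k, Module ℂ (V' k)] : Type _ :=
  ∀ a b : I, Q.Arr a b → (V a →ₗ[ℂ] V' b)

theorem finite_arrowHom_from (Q : DoubleQuiver I) (hS' : ∀ k ∉ S, Subsingleton (V' k)) (a : I) :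
    Module.Finite ℂ (∀ b, Q.Arr a b → (V a →ₗ[ℂ] V' b)) := by
  have := fun b => Q.finite_arr a b
  exact finite_pi_of_subsingleton (S := S) fun b hb => by have := hS' b hb; infer_instance

theorem finite_arrowHom (Q : DoubleQuiver I) (hS : ∀ k ∉ S, Subsingleton (V k))
    (hS' : ∀ k ∉ S, Subsingleton (V' k)) : Module.Finite ℂ (ArrowHom Q V V') := by
  have := finite_arrowHom_from (V := V) Q hS'
  exact finite_pi_of_subsingleton (S := S) fun a ha => by have := hS a ha; infer_instance

end Finite

section Extension

variable {I : Type u} {Q : DoubleQuiver.{u, v} I}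
  {V : I → Type w} {V' : I → Type w'} {V'' : I → Type w''}
  [∀ k, AddCommGroup (V k)] [∀ k, Module ℂ (V k)]
  [∀ k, AddCommGroup (V' k)] [∀ k, Module ℂ (V' k)]
  [∀ k, AddCommGroup (V'' k)] [∀ k, Module ℂ (V'' k)]
  {S : Finset I} {B : Rep Q V} {B' : Rep Q V'} {B'' : Rep Q V''}
  {φ : GradedHom V' V} {φ' : GradedHom V V''} {ψ : GradedHom V V'} {s : GradedHom V'' V}

theorem exists_splitting (h : (φ, φ') ∈ sesVariety V V' V'') :
    ∃ (ψ : GradedHom V V') (s : GradedHom V'' V), ∀ k, IsSplitting (φ k) (φ' k) (ψ k) (s k) := by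
  choose ψ s h using fun k => IsSplitting.exists_of_exact (h k).1 (h k).2.1 (h k).2.2
  exact ⟨ψ, s, h⟩

theorem mem_sesVariety_of_splitting (h : ∀ k, IsSplitting (φ k) (φ' k) (ψ k) (s k)) :
    (φ, φ') ∈ sesVariety V V' V'' := fun k => ⟨(h k).injective, (h k).exact, (h k).surjective⟩

/-- The restriction of `B` to the subobject of a split sequence. -/
def restrict (φ : GradedHom V' V) (ψ : GradedHom V V') (B : Rep Q V) : Rep Q V' :=
  fun a b h => ψ b ∘ₗ B a b h ∘ₗ φ a

theorem intertwines_restrict (h : ∀ k, IsSplitting (φ k) (φ' k) (ψ k) (s k))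
    (hB : ∀ (a b : I) (h : Q.Arr a b) (x : V' a), φ' b (B a b h (φ a x)) = 0) :
    Intertwines φ (restrict φ ψ B) B := fun a b e => by
  ext x
  have := (h b).sum (B a b e (φ a x))
  rw [hB, map_zero, add_zero] at this
  simpa [restrict] using this

theorem intertwines_restrict_quotient (h : ∀ k, IsSplitting (φ k) (φ' k) (ψ k) (s k))
    (hB : ∀ (a b : I) (h : Q.Arr a b) (x : V' a), φ' b (B a b h (φ a x)) = 0) :
    Intertwines φ' B (restrict s φ' B) := fun a b e => by
  ext x
  have := congrArg (fun y => φ' b (B a b e y)) ((h a).sum x)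
  simpa [restrict, hB] using this.symm

theorem Intertwines.eq_of_injective {B₁ B₂ : Rep Q V'} (h₁ : Intertwines φ B₁ B)
    (h₂ : Intertwines φ B₂ B) (hφ : ∀ k, Function.Injective (φ k)) : B₁ = B₂ := by
  funext a b h
  ext x
  exact hφ b ((h₁.apply h x).trans (h₂.apply h x).symm)

theorem Intertwines.eq_of_surjective {B₁ B₂ : Rep Q V''} (h₁ : Intertwines φ' B B₁)
    (h₂ : Intertwines φ' B B₂) (hφ : ∀ k, Function.Surjective (φ' k)) : B₁ = B₂ := by
  funext a b h
  ext x
  obtain ⟨y, rfl⟩ := hφ a x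
  rw [← h₁.apply, ← h₂.apply]

theorem surjective_of_exact {i : I} (h'' : ∀ k ≠ i, Subsingleton (V'' k))
    (hex : (φ, φ') ∈ sesVariety V V' V'') (k : I) (hk : k ≠ i) : Function.Surjective (φ k) :=
  fun x => ((hex k).2.1 x).1 ((h'' k hk).elim _ _)

theorem finrank_of_exact [∀ k, FiniteDimensional ℂ (V' k)]
    [∀ k, FiniteDimensional ℂ (V'' k)] (hex : (φ, φ') ∈ sesVariety V V' V'') (k : I) :
    Module.finrank ℂ (V k) = Module.finrank ℂ (V' k) + Module.finrank ℂ (V'' k) := by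
  obtain ⟨ψ, s, hs⟩ := exists_splitting hex
  exact (hs k).finrank_eq

/-! ### Which conditions pass between an extension and its two ends. -/

section Membership

variable [∀ k, FiniteDimensional ℂ (V k)] [∀ k, FiniteDimensional ℂ (V' k)]
  [∀ k, FiniteDimensional ℂ (V'' k)]

theorem charpoly_of_extension (hex : (φ, φ') ∈ sesVariety V V' V'') (H : Intertwines φ B' B)
    (H' : Intertwines φ' B B'') {a : I} (h : Q.Arr a a) :
    LinearMap.charpoly (B a a h) =
      LinearMap.charpoly (B' a a h) * LinearMap.charpoly (B'' a a h) := by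
  obtain ⟨ψ, s, hs⟩ := exists_splitting hex
  exact (hs a).charpoly_eq (H a a h) (H' a a h)

theorem mem_nilVariety_of_extension (hS : ∀ k ∉ S, Subsingleton (V k))
    (hS' : ∀ k ∉ S, Subsingleton (V' k)) (hS'' : ∀ k ∉ S, Subsingleton (V'' k))
    (hex : (φ, φ') ∈ sesVariety V V' V'') (H : Intertwines φ B' B)
    (H' : Intertwines φ' B B'') (hB : B ∈ nilVariety Q V) :
    B' ∈ nilVariety Q V' ∧ B'' ∈ nilVariety Q V'' := by
  obtain ⟨hf, hm, hr⟩ := hB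
  refine ⟨⟨hf.of_injective H fun k => (hex k).1, fun k => ?_, fun a h hh => ?_⟩,
    hf.of_surjective H' fun k => (hex k).2.2, fun k => ?_, fun a h hh => ?_⟩
  · ext x
    apply (hex k).1
    simp [H.momentMap hS hS', hm]
  · have := hr a h hh
    rw [IsRegularSemisimple, charpoly_of_extension hex H H'] at this
    exact this.of_mul_left
  · ext x
    obtain ⟨y, rfl⟩ := (hex k).2.2 x
    simp [← H'.momentMap hS'' hS, hm]
  · have := hr a h hh
    rw [IsRegularSemisimple, charpoly_of_extension hex H H'] at this
    exact this.of_mul_right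

/-- The embedding `φ i` maps `generatedAt B' i` isomorphically onto `generatedAt B i`, so `eps B i`
is `eps B' i` plus the dimension of `V''_i`. -/
theorem eps_eq_zero_of_extension {i : I} (h'' : ∀ k ≠ i, Subsingleton (V'' k))
    (hex : (φ, φ') ∈ sesVariety V V' V'') (H : Intertwines φ B' B) :
    eps B i = Module.finrank ℂ (V'' i) ↔ eps B' i = 0 := by
  have h1 := finrank_generatedAt_add_eps B i
  have h2 := finrank_generatedAt_add_eps B' i
  have h3 := finrank_of_exact hex i
  have h4 : Module.finrank ℂ (generatedAt B i) = Module.finrank ℂ (generatedAt B' i) := by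
    rw [← H.map_generatedAt (surjective_of_exact h'' hex)]
    exact ((Submodule.equivMapOfInjective _ (hex i).1 _).finrank_eq).symm
  omega

theorem mem_extStratum_iff {i : I} {l : ℕ} (hS : ∀ k ∉ S, Subsingleton (V k))
    (hS' : ∀ k ∉ S, Subsingleton (V' k)) (hS'' : ∀ k ∉ S, Subsingleton (V'' k)) :
    (B, B', B'', φ, φ') ∈ extStratum Q V V' V'' l i ↔ B ∈ nilStratum Q V l i ∧
      (φ, φ') ∈ sesVariety V V' V'' ∧ Intertwines φ B' B ∧ Intertwines φ' B B'' := by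
  constructor
  · rintro ⟨⟨_, _, _, h1, h2, h3⟩, h4⟩
    exact ⟨h4, h1, h2, h3⟩
  · rintro ⟨h4, h1, h2, h3⟩
    have := mem_nilVariety_of_extension hS hS' hS'' h1 h2 h3 h4.1
    exact ⟨⟨this.1, this.2, h4.1, h1, h2, h3⟩, h4⟩

/-- Given the two ends, the moment map is the only condition left on the extension. Flags
concatenate, the value of `eps` is automatic, and a product of separable characteristic polynomials
is separable exactly when the factors are coprime, which is the disjointness of the spectra. -/
theorem mem_extStratum_iff_regProduct {i : I} {l : ℕ} (hS : ∀ k ∉ S, Subsingleton (V k))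
    (hS' : ∀ k ∉ S, Subsingleton (V' k)) (hS'' : ∀ k ∉ S, Subsingleton (V'' k))
    (h'' : ∀ k ≠ i, Subsingleton (V'' k)) (hl : Module.finrank ℂ (V'' i) = l) :
    (B, B', B'', φ, φ') ∈ extStratum Q V V' V'' l i ↔ (B', B'') ∈ regProduct Q V' V'' 0 i ∧
      (φ, φ') ∈ sesVariety V V' V'' ∧ Intertwines φ B' B ∧ Intertwines φ' B B'' ∧
      ∀ k, momentMap B k = 0 := by
  rw [mem_extStratum_iff hS hS' hS'']
  constructor
  · rintro ⟨h4, h1, h2, h3⟩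
    have := mem_nilVariety_of_extension hS hS' hS'' h1 h2 h3 h4.1
    refine ⟨⟨⟨this.1, (eps_eq_zero_of_extension h'' h1 h2).1 (h4.2.trans hl.symm)⟩, this.2,
      fun h hh => ?_⟩, h1, h2, h3, h4.1.2.1⟩
    rw [disjoint_spectrum_iff]
    have := h4.1.2.2 i h hh
    rw [IsRegularSemisimple, charpoly_of_extension h1 h2 h3] at this
    exact this.isCoprime
  · rintro ⟨h4, h1, h2, h3, hm⟩
    refine ⟨⟨⟨HasAdaptedFlag.extension h2 h3 h1 h4.1.1.1 h4.2.1.1, hm, fun a h hh => ?_⟩,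
      ((eps_eq_zero_of_extension h'' h1 h2).2 h4.1.2).trans hl⟩, h1, h2, h3⟩
    rw [IsRegularSemisimple, charpoly_of_extension h1 h2 h3]
    refine Polynomial.Separable.mul (h4.1.1.2.2 a h hh) (h4.2.1.2.2 a h hh) ?_
    by_cases ha : a = i
    · subst ha
      exact (disjoint_spectrum_iff _ _).1 (h4.2.2 h hh)
    -- Away from `i` the quotient is zero, so its characteristic polynomial is `1` and coprimality
    -- is free.
    · have := h'' a ha
      have h1 : LinearMap.charpoly (B'' a a h) = 1 :=
        (LinearMap.charpoly_monic _).natDegree_eq_zero.1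
          ((LinearMap.charpoly_natDegree _).trans (Module.finrank_zero_of_subsingleton))
      rw [h1]
      exact isCoprime_one_right

end Membership

/-! ### The equation for the extensions with given sub and quotient -/

/-- The operators on the middle term of a split sequence with given restriction and quotient. -/
def glue (φ : GradedHom V' V) (φ' : GradedHom V V'') (ψ : GradedHom V V') (s : GradedHom V'' V)
    (B' : Rep Q V') (B'' : Rep Q V'') (C : ArrowHom Q V'' V') : Rep Q V := fun a b h =>
  φ b ∘ₗ B' a b h ∘ₗ ψ a + s b ∘ₗ B'' a b h ∘ₗ φ' a + φ b ∘ₗ C a b h ∘ₗ φ' a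

/-- The off-diagonal component of a family of operators on the middle term. -/
def offDiagonal (ψ : GradedHom V V') (s : GradedHom V'' V) : Rep Q V →ₗ[ℂ] ArrowHom Q V'' V' where
  toFun B := fun a b h => ψ b ∘ₗ B a b h ∘ₗ s a
  map_add' _ _ := by funext; simp [LinearMap.add_comp, LinearMap.comp_add]
  map_smul' _ _ := by funext; simp [LinearMap.smul_comp, LinearMap.comp_smul]

theorem intertwines_glue (h : ∀ k, IsSplitting (φ k) (φ' k) (ψ k) (s k)) (C : ArrowHom Q V'' V') :
    Intertwines φ B' (glue φ φ' ψ s B' B'' C) := fun a b e => by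
  ext x
  simp [glue, (h _).retraction, (h _).comp_eq_zero]

theorem intertwines_glue_quotient (h : ∀ k, IsSplitting (φ k) (φ' k) (ψ k) (s k))
    (C : ArrowHom Q V'' V') : Intertwines φ' (glue φ φ' ψ s B' B'' C) B'' := fun a b e => by
  ext x
  simp [glue, (h _).cosection, (h _).comp_eq_zero]

theorem offDiagonal_glue (h : ∀ k, IsSplitting (φ k) (φ' k) (ψ k) (s k)) (C : ArrowHom Q V'' V') :
    offDiagonal ψ s (glue φ φ' ψ s B' B'' C) = C := by
  funext a b e
  ext x
  simp [glue, offDiagonal, (h _).cosection, (h _).retraction, (h _).retraction_section]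

theorem glue_offDiagonal (h : ∀ k, IsSplitting (φ k) (φ' k) (ψ k) (s k)) (H : Intertwines φ B' B)
    (H' : Intertwines φ' B B'') : glue φ φ' ψ s B' B'' (offDiagonal ψ s B) = B := by
  funext a b e
  ext x
  have h1 := (h b).sum (B a b e x)
  have h2 := congrArg (B a b e) ((h a).sum x)
  rw [H'.apply] at h1
  have h3 := congrArg (fun y => φ b (ψ b y)) h2
  simp only [map_add, ← H.apply, (h _).retraction] at h3
  simp only [glue, offDiagonal, LinearMap.add_apply, LinearMap.comp_apply, LinearMap.coe_mk,
    AddHom.coe_mk]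
  rw [← h1, ← h3]
  abel

/-- The off-diagonal component of the moment map of an extension. -/
noncomputable def extMoment (S : Finset I) (B' : Rep Q V') (B'' : Rep Q V'') :
    ArrowHom Q V'' V' →ₗ[ℂ] GradedHom V'' V' where
  toFun C := fun k => ∑ h ∈ arrows Q k S, sgn h.2 • (B' h.1 k (Q.bar h.2) ∘ₗ C k h.1 h.2 +
    C h.1 k (Q.bar h.2) ∘ₗ B'' k h.1 h.2)
  map_add' C C' := by
    funext k
    simp only [Pi.add_apply, LinearMap.comp_add, LinearMap.add_comp, ← Finset.sum_add_distrib]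
    refine Finset.sum_congr rfl fun h _ => ?_
    rw [← smul_add]
    congr 1
    abel
  map_smul' c C := by
    funext k
    simp only [Pi.smul_apply, LinearMap.comp_smul, LinearMap.smul_comp, Finset.smul_sum,
      RingHom.id_apply]
    refine Finset.sum_congr rfl fun h _ => ?_
    rw [smul_comm, ← smul_add]

/-- For a block triangular `B`, the diagonal blocks of the moment map are those of `B'` and `B''`,
which vanish; only the off-diagonal block, linear in `C`, survives. -/
theorem momentMap_glue (hS : ∀ k ∉ S, Subsingleton (V k)) (hS' : ∀ k ∉ S, Subsingleton (V' k))
    (hS'' : ∀ k ∉ S, Subsingleton (V'' k))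
    (h : ∀ k, IsSplitting (φ k) (φ' k) (ψ k) (s k)) (C : ArrowHom Q V'' V') (k : I)
    (hB' : momentMap B' k = 0) (hB'' : momentMap B'' k = 0) :
    momentMap (glue φ φ' ψ s B' B'' C) k = φ k ∘ₗ extMoment S B' B'' C k ∘ₗ φ' k := by
  rw [momentMap_eq_sum hS'] at hB'
  rw [momentMap_eq_sum hS''] at hB''
  rw [momentMap_eq_sum hS]
  ext x
  have h1 := congrArg (φ k) (LinearMap.congr_fun hB' (ψ k x))
  have h2 := congrArg (s k) (LinearMap.congr_fun hB'' (φ' k x))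
  simp only [LinearMap.sum_apply, map_sum, LinearMap.smul_apply, LinearMap.comp_apply,
    LinearMap.zero_apply, map_zero, map_smul] at h1 h2
  simp only [glue, extMoment, LinearMap.sum_apply, map_sum, LinearMap.smul_apply,
    LinearMap.comp_apply, LinearMap.add_apply, LinearMap.coe_mk, AddHom.coe_mk, map_add, map_smul,
    (h _).retraction, (h _).cosection, (h _).comp_eq_zero, (h _).retraction_section, map_zero,
    zero_add, add_zero, smul_add, Finset.sum_add_distrib, h1, h2]
  abel

theorem momentMap_glue_eq_zero_iff (hS : ∀ k ∉ S, Subsingleton (V k))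
    (hS' : ∀ k ∉ S, Subsingleton (V' k)) (hS'' : ∀ k ∉ S, Subsingleton (V'' k))
    (h : ∀ k, IsSplitting (φ k) (φ' k) (ψ k) (s k)) (C : ArrowHom Q V'' V')
    (hB' : ∀ k, momentMap B' k = 0) (hB'' : ∀ k, momentMap B'' k = 0) :
    (∀ k, momentMap (glue φ φ' ψ s B' B'' C) k = 0) ↔ extMoment S B' B'' C = 0 := by
  constructor
  · intro h0
    funext k
    ext y
    have := LinearMap.congr_fun (h0 k) (s k y)
    rw [momentMap_glue hS hS' hS'' h C k (hB' k) (hB'' k)] at this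
    apply (h k).injective
    simpa [(h k).cosection] using this
  · intro h0 k
    rw [momentMap_glue hS hS' hS'' h C k (hB' k) (hB'' k), h0]
    simp

/-- By duality it suffices that a functional vanishing on the range is zero. It only sees the
component at `i`, and the vectors `v` for which it kills every rank-one map with image in the line
of `v` form a subspace to which minimality of `generatedAt` applies. -/
theorem extMoment_surjective [∀ k, FiniteDimensional ℂ (V'' k)] {i : I}
    (hfin : Module.Finite ℂ (GradedHom V'' V'))
    (hS' : ∀ k ∉ S, Subsingleton (V' k)) (h'' : ∀ k ≠ i, Subsingleton (V'' k))
    (hgen : generatedAt B' i = ⊤) (B'' : Rep Q V'') :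
    Function.Surjective (extMoment S B' B'') := by
  classical
  rw [← LinearMap.range_eq_top, ← Submodule.dualAnnihilator_eq_bot_iff, eq_bot_iff]
  intro c hc
  rw [Submodule.mem_dualAnnihilator] at hc
  let lam : Module.Dual ℂ (V'' i →ₗ[ℂ] V' i) := c ∘ₗ LinearMap.single ℂ (fun k => V'' k →ₗ[ℂ] V' k) i
  have hlam : ∀ f, c f = lam (f i) := fun f => by
    change c f = c (Pi.single i (f i))
    congr 1
    funext k
    by_cases hk : k = i
    · subst hk; simp
    · have := h'' k hk
      exact Subsingleton.elim _ _
  have hsum : ∀ C, lam (extMoment S B' B'' C i) = 0 := fun C => by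
    rw [← hlam]
    exact hc _ ⟨C, rfl⟩
  let N : Submodule ℂ (V' i) :=
    { carrier := {v | ∀ ξ : Module.Dual ℂ (V'' i), lam (ξ.smulRight v) = 0}
      add_mem' := fun {x y} hx hy ξ => by
        rw [show ξ.smulRight (x + y) = ξ.smulRight x + ξ.smulRight y by ext; simp, map_add, hx, hy,
          add_zero]
      zero_mem' := fun ξ => by
        rw [show ξ.smulRight (0 : V' i) = 0 by ext; simp, map_zero]
      smul_mem' := fun a x hx ξ => by
        rw [show ξ.smulRight (a • x) = a • ξ.smulRight x by ext; simp [smul_comm _ a], map_smul, hx,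
          smul_zero] }
  have hN : N = ⊤ := by
    rw [eq_top_iff, ← hgen]
    refine generatedAt_le (fun j hj h => ?_) fun h => ?_
    · rintro _ ⟨x, rfl⟩ ξ
      by_cases hjS : j ∈ S
      -- Test against the family `C` whose only component is `ξ ⊗ x` on `Q.bar h`: as `j ≠ i`, the
      -- only surviving term is, up to sign, `B'_h ∘ (ξ ⊗ x) = ξ ⊗ B'_h x`.
      · have := hsum (Pi.single i (Pi.single j (Pi.single (Q.bar h) (ξ.smulRight x))))
        change lam (∑ e ∈ arrows Q i S, _) = 0 at this
        rw [Finset.sum_eq_single (⟨j, Q.bar h⟩ : Σ j, Q.Arr i j)] at this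
        · simp only [Pi.single_eq_same, Q.bar_bar, Pi.single_eq_of_ne hj, Pi.zero_apply,
            LinearMap.zero_comp, add_zero, map_smul, smul_eq_mul, mul_eq_zero, sgn_ne_zero,
            false_or] at this
          rw [← this]
          congr 1
          ext; simp
        · rintro ⟨k, e⟩ - hne
          have h1 : (Pi.single j (Pi.single (Q.bar h) (ξ.smulRight x)) :
              ∀ b, Q.Arr i b → (V'' i →ₗ[ℂ] V' b)) k e = 0 := by
            by_cases hk : k = j
            · subst hk
              rw [Pi.single_eq_same, Pi.single_eq_of_ne fun h0 => hne (by rw [h0])]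
            · rw [Pi.single_eq_of_ne hk, Pi.zero_apply]
          have h2 : (Pi.single i (Pi.single j (Pi.single (Q.bar h) (ξ.smulRight x))) :
              ArrowHom Q V'' V') k i (Q.bar e) = 0 := by
            by_cases hk : k = i
            · subst hk
              rw [Pi.single_eq_same, Pi.single_eq_of_ne hj.symm, Pi.zero_apply]
            · rw [Pi.single_eq_of_ne hk, Pi.zero_apply, Pi.zero_apply]
          dsimp only
          rw [h2, Pi.single_eq_same, h1, LinearMap.comp_zero, LinearMap.zero_comp, add_zero,
            smul_zero]
        · intro h; exact absurd (mem_arrows.2 hjS) h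
      · have := hS' j hjS
        rw [Subsingleton.elim x 0, map_zero]
        exact N.zero_mem ξ
    · rintro _ ⟨x, hx, rfl⟩ ξ
      by_cases hiS : i ∈ S
      -- A loop differs from its opposite because exactly one of them lies in `Ω`; hence the family
      -- concentrated on `Q.bar h` has no component on `h`.
      · have hne : h ≠ Q.bar h := fun h0 => by
          have := Q.bar_mem_Ω h
          rw [← h0] at this
          tauto
        have := hsum (Pi.single i (Pi.single i (Pi.single (Q.bar h) (ξ.smulRight x))))
        change lam (∑ e ∈ arrows Q i S, _) = 0 at this
        rw [map_sum, Finset.sum_eq_single (⟨i, Q.bar h⟩ : Σ j, Q.Arr i j)] at this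
        · simp only [Pi.single_eq_same, Q.bar_bar, Pi.single_eq_of_ne hne,
            LinearMap.zero_comp, add_zero, map_smul, smul_eq_mul, mul_eq_zero, sgn_ne_zero,
            false_or] at this
          rw [← this]
          congr 1
          ext; simp
        · rintro ⟨k, e⟩ - he
          by_cases hk : k = i
          · subst hk
            have h1 : e ≠ Q.bar h := fun h0 => he (by rw [h0])
            simp only [Pi.single_eq_same, Pi.single_eq_of_ne h1, LinearMap.comp_zero, zero_add,
              map_smul]
            -- For a loop there is a second contribution, from `e = h`: it is `(ξ ∘ B''_h) ⊗ x`,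
            -- killed because `x` already lies in `N` and `N` quantifies over all `ξ`.
            by_cases h2 : e = h
            · subst h2
              rw [Pi.single_eq_same, show (ξ.smulRight x) ∘ₗ B'' k k e =
                (ξ ∘ₗ B'' k k e).smulRight x by ext; simp, hx, smul_zero]
            · have h3 : Q.bar e ≠ Q.bar h := fun h0 => h2 (by
                rw [← Q.bar_bar e, h0, Q.bar_bar])
              rw [Pi.single_eq_of_ne h3, LinearMap.zero_comp, map_zero, smul_zero]
          · simp only [Pi.single_eq_same, Pi.single_eq_of_ne hk, Pi.zero_apply,
              LinearMap.comp_zero, LinearMap.zero_comp, add_zero, smul_zero, map_zero]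
        · intro h; exact absurd (mem_arrows.2 hiS) h
      · have := hS' i hiS
        rw [Subsingleton.elim x 0, map_zero]
        exact N.zero_mem ξ
  have hall : ∀ (ξ : Module.Dual ℂ (V'' i)) (v : V' i), lam (ξ.smulRight v) = 0 := fun ξ v =>
    (hN ▸ Submodule.mem_top : v ∈ N) ξ
  rw [Submodule.mem_bot]
  ext f
  rw [hlam]
  -- The maps of rank at most one span `Hom(V''_i, V'_i)`.
  let b := Module.finBasis ℂ (V'' i)
  have hf : f i = ∑ t, (b.coord t).smulRight (f i (b t)) := by
    refine b.ext fun t => ?_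
    simp [LinearMap.sum_apply, Finsupp.single_apply]
  rw [hf, map_sum]
  exact Finset.sum_eq_zero fun t _ => hall _ _

end Extension

/-! ## The principal bundle -/

section SplittingVariation

variable {V V' V'' : Type*} [AddCommGroup V] [Module ℂ V] [AddCommGroup V'] [Module ℂ V']
  [AddCommGroup V''] [Module ℂ V''] {φ₀ φ : V' →ₗ[ℂ] V} {φ₀' φ' : V →ₗ[ℂ] V''}
  {ψ₀ ψ : V →ₗ[ℂ] V'} {s₀ s : V'' →ₗ[ℂ] V}

/-- When the embedding moves, the old section is kept: `φ ∘ a ∘ ψ₀` is the projection onto the new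
image along the range of `s₀`. -/
theorem IsSplitting.of_embedding (h : IsSplitting φ₀ φ₀' ψ₀ s₀) {a : Module.End ℂ V'}
    (ha : ∀ x, a (ψ₀ (φ x)) = x) (ha' : ∀ x, ψ₀ (φ (a x)) = x) :
    IsSplitting φ (φ₀' ∘ₗ (LinearMap.id - φ ∘ₗ a ∘ₗ ψ₀)) (a ∘ₗ ψ₀) s₀ where
  retraction := ha
  cosection y := by simp [h.retraction_section, h.cosection]
  sum v := by
    have := h.sum (v - φ (a (ψ₀ v)))
    rw [map_sub ψ₀, ha', sub_self, map_zero, zero_add] at this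
    simp only [LinearMap.comp_apply, LinearMap.sub_apply, LinearMap.id_apply, this]
    abel

/-- When the whole sequence moves, the old splitting is corrected by inverses of the comparison maps
`ψ₀ ∘ φ` and `φ' ∘ s₀`, so it depends regularly on the sequence. -/
theorem IsSplitting.of_exact (hex : Function.Exact φ φ')
    {a : Module.End ℂ V'} {c : Module.End ℂ V''} (ha : ∀ x, a (ψ₀ (φ x)) = x)
    (hc : ∀ y, φ' (s₀ (c y)) = y) :
    IsSplitting φ φ' (a ∘ₗ ψ₀ ∘ₗ (LinearMap.id - s₀ ∘ₗ c ∘ₗ φ')) (s₀ ∘ₗ c) where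
  retraction x := by simp [hex.apply_apply_eq_zero, ha]
  cosection y := hc y
  sum v := by
    obtain ⟨x, hx⟩ := (hex (v - s₀ (c (φ' v)))).1 (by simp [hc])
    simp [← hx, ha]
    rw [hx, sub_add_cancel]

/-- The vanishing of `φ' ∘ φ₀` puts the image of `φ₀` inside that of `φ`. Exchanging the two
sequences gives the opposite composite, so embeddings with the same image differ by an automorphism
of `V'`. -/
theorem IsSplitting.comparison (h₀ : IsSplitting φ₀ φ₀' ψ₀ s₀) (h : IsSplitting φ φ' ψ s)
    (h0 : ∀ x, φ' (φ₀ x) = 0) (x : V') : ψ₀ (φ (ψ (φ₀ x))) = x := by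
  have := h.sum (φ₀ x)
  rw [h0, map_zero, add_zero] at this
  rw [this, h₀.retraction]

theorem IsSplitting.comparison_quotient (h₀ : IsSplitting φ₀ φ₀' ψ₀ s₀)
    (h : IsSplitting φ φ' ψ s) (h0 : ∀ x, φ' (φ₀ x) = 0) (y : V'') :
    φ' (s₀ (φ₀' (s y))) = y := by
  have := congrArg φ' (h₀.sum (s y))
  rwa [map_add, h0, zero_add, h.cosection] at this

end SplittingVariation

/-! ### Regularity of compositions of graded maps and operators. -/

section RegularGraded

variable {I : Type*} {E : Type*} [AddCommGroup E] [Module ℂ E] {T : Set E}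
  {V V' V'' : I → Type*}
  [∀ k, AddCommGroup (V k)] [∀ k, Module ℂ (V k)] [∀ k, FiniteDimensional ℂ (V k)]
  [∀ k, AddCommGroup (V' k)] [∀ k, Module ℂ (V' k)] [∀ k, FiniteDimensional ℂ (V' k)]
  [∀ k, AddCommGroup (V'' k)] [∀ k, Module ℂ (V'' k)] [∀ k, FiniteDimensional ℂ (V'' k)]

theorem IsRegularOn.gradedComp [Module.Finite ℂ (GradedHom V V'')] {f : E → GradedHom V' V''}
    {g : E → GradedHom V V'} (hf : IsRegularOn T f) (hg : IsRegularOn T g) :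
    IsRegularOn T fun x => (fun k => f x k ∘ₗ g x k : GradedHom V V'') :=
  pi fun k => (hf.proj k).comp_hom (hg.proj k)

theorem IsRegularOn.repComp {Q : DoubleQuiver I} {S : Finset I}
    {W : I → Type*} [∀ k, AddCommGroup (W k)] [∀ k, Module ℂ (W k)]
    [∀ k, FiniteDimensional ℂ (W k)] (hS : ∀ k ∉ S, Subsingleton (V k))
    (hW : ∀ k ∉ S, Subsingleton (W k)) {f : E → GradedHom V'' W}
    {B : E → ArrowHom Q V' V''} {g : E → GradedHom V V'} (hf : IsRegularOn T f)
    (hB : IsRegularOn T B) (hg : IsRegularOn T g) :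
    IsRegularOn T fun x => (fun a b h => f x b ∘ₗ B x a b h ∘ₗ g x a : ArrowHom Q V W) := by
  have := finite_arrowHom Q hS hW
  have := finite_arrowHom_from (V := V) Q hW
  have := fun a b => Q.finite_arr a b
  refine pi fun a => pi fun b => pi fun h => ?_
  exact (hf.proj b).comp_hom ((((hB.proj a).proj b).proj h).comp_hom (hg.proj a))

end RegularGraded

theorem ringInverse_eq {A : Type*} [MonoidWithZero A] {a b : A} (h : a * b = 1) (h' : b * a = 1) :
    Ring.inverse a = b := Ring.inverse_unit ⟨a, b, h, h'⟩

/-! ### The gauge group and its action on extensions. -/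

section Gauge

variable {I : Type u} {Q : DoubleQuiver.{u, v} I}
  {V : I → Type w} {V' : I → Type w'} {V'' : I → Type w''}
  [∀ k, AddCommGroup (V k)] [∀ k, Module ℂ (V k)]
  [∀ k, AddCommGroup (V' k)] [∀ k, Module ℂ (V' k)]
  [∀ k, AddCommGroup (V'' k)] [∀ k, Module ℂ (V'' k)]
  {S : Finset I} {i : I} {l : ℕ}

section Inverse

variable (g : (GradedEnd V' × GradedEnd V'')ˣ)

theorem unit_fst_val_inv (k : I) (x : V' k) : g.val.1 k (g⁻¹.val.1 k x) = x :=
  LinearMap.congr_fun (congrFun (congrArg Prod.fst g.val_inv) k) x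

theorem unit_fst_inv_val (k : I) (x : V' k) : g⁻¹.val.1 k (g.val.1 k x) = x :=
  LinearMap.congr_fun (congrFun (congrArg Prod.fst g.inv_val) k) x

theorem unit_snd_val_inv (k : I) (x : V'' k) : g.val.2 k (g⁻¹.val.2 k x) = x :=
  LinearMap.congr_fun (congrFun (congrArg Prod.snd g.val_inv) k) x

theorem unit_snd_inv_val (k : I) (x : V'' k) : g⁻¹.val.2 k (g.val.2 k x) = x :=
  LinearMap.congr_fun (congrFun (congrArg Prod.snd g.inv_val) k) x

end Inverse

/-- The action of the gauge group, as a function on the ambient vector space. -/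
noncomputable def gaugeFun (g : GradedEnd V' × GradedEnd V'') (x : ExtSpace Q V V' V'') :
    ExtSpace Q V V' V'' :=
  (x.1,
    fun a b h => g.1 b ∘ₗ x.2.1 a b h ∘ₗ (Ring.inverse g).1 a,
    fun a b h => g.2 b ∘ₗ x.2.2.1 a b h ∘ₗ (Ring.inverse g).2 a,
    fun k => x.2.2.2.1 k ∘ₗ (Ring.inverse g).1 k,
    fun k => g.2 k ∘ₗ x.2.2.2.2 k)

theorem gaugeFun_val (g : (GradedEnd V' × GradedEnd V'')ˣ) (x : ExtSpace Q V V' V'') :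
    gaugeFun g.val x = gaugeAct g x := by
  rw [gaugeFun, Ring.inverse_unit]
  rfl

theorem gaugeAct_mul (g g' : (GradedEnd V' × GradedEnd V'')ˣ) (x : ExtSpace Q V V' V'') :
    gaugeAct (g * g') x = gaugeAct g (gaugeAct g' x) := by
  have h : (g * g').inv = g'.inv * g.inv := rfl
  simp only [gaugeAct, h]
  rfl

theorem gaugeAct_one (x : ExtSpace Q V V' V'') :
    gaugeAct (1 : (GradedEnd V' × GradedEnd V'')ˣ) x = x := rfl

variable [∀ k, FiniteDimensional ℂ (V k)] [∀ k, FiniteDimensional ℂ (V' k)]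
  [∀ k, FiniteDimensional ℂ (V'' k)]

/-- Injectivity of `φ` determines `B'` from `B`, and surjectivity of `φ'` determines `B''`. -/
theorem extVariety_ext {x y : ExtSpace Q V V' V''} (hx : x ∈ extVariety Q V V' V'')
    (hy : y ∈ extVariety Q V V' V'') (h : x.1 = y.1) (h' : x.2.2.2 = y.2.2.2) : x = y := by
  obtain ⟨B, B₁', B₁'', φ, φ'⟩ := x
  obtain ⟨_, B₂', B₂'', _, _⟩ := y
  obtain rfl : B = _ := h
  cases h'
  obtain ⟨-, -, -, hex, hx, hx'⟩ := hx
  obtain ⟨-, -, -, -, hy, hy'⟩ := hy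
  rw [Intertwines.eq_of_injective hx hy fun k => (hex k).1,
    Intertwines.eq_of_surjective hx' hy' fun k => (hex k).2.2]

variable (hS : ∀ k ∉ S, Subsingleton (V k)) (hS' : ∀ k ∉ S, Subsingleton (V' k))
  (hS'' : ∀ k ∉ S, Subsingleton (V'' k))

include hS hS' hS''

theorem gaugeAct_mem (g : (GradedEnd V' × GradedEnd V'')ˣ) {x : ExtSpace Q V V' V''}
    (hx : x ∈ extStratum Q V V' V'' l i) : gaugeAct g x ∈ extStratum Q V V' V'' l i := by
  obtain ⟨B, B', B'', φ, φ'⟩ := x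
  rw [mem_extStratum_iff hS hS' hS''] at hx
  obtain ⟨hB, hex, H, H'⟩ := hx
  obtain ⟨ψ, s, h⟩ := exists_splitting hex
  refine (mem_extStratum_iff hS hS' hS'').2 ⟨hB, mem_sesVariety_of_splitting
    (ψ := fun k => g.val.1 k ∘ₗ ψ k) (s := fun k => s k ∘ₗ g.inv.2 k) fun k => ⟨?_, ?_, ?_⟩,
    fun a b e => ?_, fun a b e => ?_⟩
  · intro x
    simp [(h k).retraction, unit_fst_val_inv]
  · intro x
    simp [(h k).cosection, unit_snd_val_inv]
  · intro x
    simp [(h k).sum, unit_fst_inv_val, unit_snd_inv_val]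
  · ext x
    simp [unit_fst_inv_val, H.apply]
  · ext x
    simp [unit_snd_inv_val, H'.apply]

theorem isRegularOn_gaugeFun : IsRegularOn
    (unitsVariety (GradedEnd V' × GradedEnd V'') ×ˢ (Set.univ : Set (ExtSpace Q V V' V'')))
    fun y => gaugeFun y.1 y.2 := by
  have := finite_gradedHom (V' := V) hS'
  have := finite_gradedHom (V' := V'') hS
  have := finite_gradedHom (V' := V') hS'
  have := finite_gradedHom (V' := V'') hS''
  have := finite_arrowHom Q hS hS
  have := finite_arrowHom Q hS' hS'
  have := finite_arrowHom Q hS'' hS''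
  have hid := IsRegularOn.id (S := unitsVariety (GradedEnd V' × GradedEnd V'') ×ˢ
    (Set.univ : Set (ExtSpace Q V V' V'')))
  have hg := hid.fst
  have hx := hid.snd
  have hi := hg.ringInverse fun y hy => hy.1
  exact hx.fst.prodMk ((IsRegularOn.repComp hS' hS' hg.fst hx.snd.fst hi.fst).prodMk
    ((IsRegularOn.repComp hS'' hS'' hg.snd hx.snd.snd.fst hi.snd).prodMk
      ((hx.snd.snd.snd.fst.gradedComp hi.fst).prodMk
        (hg.snd.gradedComp hx.snd.snd.snd.snd))))

end Gauge

/-! ### Regular local sections and local triviality of `q`. -/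

section LocalEmbedding

variable {I : Type u} {Q : DoubleQuiver.{u, v} I}
  {V : I → Type w} {V' : I → Type w'} {V'' : I → Type w''}
  [∀ k, AddCommGroup (V k)] [∀ k, Module ℂ (V k)]
  [∀ k, AddCommGroup (V' k)] [∀ k, Module ℂ (V' k)]
  [∀ k, AddCommGroup (V'' k)] [∀ k, Module ℂ (V'' k)]
  {S : Finset I} {i : I} {l : ℕ}

/-- A vector obtained by applying a noncommutative polynomial in the loops to a vector in the
image of an arrow that is not a loop. -/
noncomputable def generator (i : I)
    (e : FreeAlgebra ℂ (Q.Arr i i) × Σ (j : {j : I // j ≠ i}), Q.Arr j i × V j) (B : Rep Q V) :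
    V i :=
  FreeAlgebra.lift ℂ (A := Module.End ℂ (V i)) (B i i) e.1 (B e.2.1 i e.2.2.1 e.2.2.2)

theorem generator_mem (B : Rep Q V)
    (e : FreeAlgebra ℂ (Q.Arr i i) × Σ (j : {j : I // j ≠ i}), Q.Arr j i × V j) :
    generator i e B ∈ generatedAt B i := by
  refine map_loopAlgebra_le_generatedAt e.2.1.2 _ ?_ _
  rw [loopAlgebra, Algebra.adjoin_range_eq_range_freeAlgebra_lift]
  exact ⟨e.1, rfl⟩

/-- The generators are indexed independently of `B`, so a choice made at one point makes sense at
all others. -/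
theorem span_generator (B : Rep Q V) :
    Submodule.span ℂ (Set.range fun e => generator i e B) = generatedAt B i := by
  apply le_antisymm
  · rw [Submodule.span_le]
    rintro _ ⟨e, rfl⟩
    exact generator_mem B e
  · refine generatedAt_le (fun j hj h => ?_) fun h => ?_
    · rintro _ ⟨x, rfl⟩
      exact Submodule.subset_span ⟨(1, ⟨⟨j, hj⟩, h, x⟩), by simp [generator]⟩
    · rw [Submodule.map_span, Submodule.span_le]
      rintro _ ⟨_, ⟨e, rfl⟩, rfl⟩
      exact Submodule.subset_span ⟨(FreeAlgebra.ι ℂ h * e.1, e.2), by simp [generator]⟩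

theorem exists_complement [∀ k, FiniteDimensional ℂ (V k)]
    [∀ k, FiniteDimensional ℂ (V'' k)] (φ : GradedHom V' V) (hφ : ∀ k, Function.Injective (φ k))
    (hd : ∀ k, Module.finrank ℂ (V k) = Module.finrank ℂ (V' k) + Module.finrank ℂ (V'' k)) :
    ∃ φ' : GradedHom V V'', (φ, φ') ∈ sesVariety V V' V'' := by
  have h1 : ∀ k, Module.finrank ℂ (V k ⧸ LinearMap.range (φ k)) = Module.finrank ℂ (V'' k) :=
    fun k => by
      have := Submodule.finrank_quotient_add_finrank (LinearMap.range (φ k))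
      rw [LinearMap.finrank_range_of_inj (hφ k)] at this
      have := hd k
      omega
  refine ⟨fun k => (LinearEquiv.ofFinrankEq _ _ (h1 k)).toLinearMap ∘ₗ
    (LinearMap.range (φ k)).mkQ, fun k => ⟨hφ k, ?_, ?_⟩⟩
  · rw [LinearMap.exact_iff]
    simp [LinearMap.ker_comp]
  · exact (LinearEquiv.surjective _).comp (Submodule.mkQ_surjective _)

variable [∀ k, FiniteDimensional ℂ (V k)] [∀ k, FiniteDimensional ℂ (V' k)]
  [∀ k, FiniteDimensional ℂ (V'' k)]

theorem isRegularOn_generator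
    (e : FreeAlgebra ℂ (Q.Arr i i) × Σ (j : {j : I // j ≠ i}), Q.Arr j i × V j)
    (T : Set (Rep Q V)) : IsRegularOn T (generator i e) := by
  have key : ∀ f : FreeAlgebra ℂ (Q.Arr i i), IsRegularOn T fun B : Rep Q V =>
      FreeAlgebra.lift ℂ (A := Module.End ℂ (V i)) (B i i) f := fun f => by
    induction f using FreeAlgebra.induction with
    | grade0 r =>
      simp only [AlgHom.commutes]
      exact IsRegularOn.const _
    | grade1 h =>
      simp only [FreeAlgebra.lift_ι_apply]
      exact ((IsRegularOn.id.proj i).proj i).proj h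
    | mul a b ha hb =>
      simp only [map_mul]
      exact ha.comp_hom hb
    | add a b ha hb =>
      simp only [map_add]
      exact ha.add hb
  exact IsRegularOn.bilinear LinearMap.id (key e.1)
    ((((IsRegularOn.id.proj e.2.1.1).proj i).proj e.2.2.1).apply e.2.2.2)

/-- Generators forming a basis at `B₀` are kept as expressions and evaluated at `B`. The image stays
inside `generatedAt B i` for every `B`, while injectivity is only claimed at `B₀`. -/
theorem exists_regular_embedding [Module.Finite ℂ (GradedHom V' V)]
    (hd : ∀ k ≠ i, Module.finrank ℂ (V k) = Module.finrank ℂ (V' k)) (B₀ : Rep Q V)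
    (h₀ : Module.finrank ℂ (generatedAt B₀ i) = Module.finrank ℂ (V' i)) :
    ∃ φ : Rep Q V → GradedHom V' V, (∀ T, IsRegularOn T φ) ∧
      (∀ k, Function.Injective (φ B₀ k)) ∧
      ∀ B, LinearMap.range (φ B i) ≤ generatedAt B i := by
  classical
  have h1 : Module.finrank ℂ (Submodule.span ℂ (Set.range fun e => generator i e B₀)) =
      Module.finrank ℂ (V' i) := by rw [span_generator, h₀]
  obtain ⟨f, hf, -, hli⟩ := Submodule.exists_fun_fin_finrank_span_eq ℂ
    (Set.range fun e => generator i e B₀)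
  choose e he using hf
  let b := (Module.finBasis ℂ (V' i)).reindex (finCongr h1.symm)
  have hφ : ∀ k, ∃ φ : V' k →ₗ[ℂ] V k, k ≠ i → Function.Injective φ := fun k => by
    by_cases hk : k = i
    · exact ⟨0, fun h => absurd hk h⟩
    · exact ⟨(LinearEquiv.ofFinrankEq _ _ (hd k hk).symm).toLinearMap, fun _ =>
        LinearEquiv.injective _⟩
  choose φ hφ using hφ
  refine ⟨fun B => Function.update φ i (b.constr ℂ fun t => generator i (e t) B), fun T => ?_,
    fun k => ?_, fun B => ?_⟩
  · refine IsRegularOn.pi fun k => ?_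
    by_cases hk : k = i
    · subst hk
      simp only [Function.update_self]
      exact IsRegularOn.linear_comp (b.constr ℂ).toLinearMap
        (IsRegularOn.pi fun t => isRegularOn_generator (e t) T)
    · simp only [Function.update_of_ne hk]
      exact IsRegularOn.const _
  · by_cases hk : k = i
    · subst hk
      simp only [Function.update_self, he]
      refine (injective_iff_map_eq_zero _).2 fun x hx => b.repr.map_eq_zero_iff.1 ?_
      rw [b.constr_apply_fintype (S := ℂ)] at hx
      ext t
      exact Fintype.linearIndependent_iff.1 hli _ hx t
    · simp only [Function.update_of_ne hk]
      exact hφ k hk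
  · simp only [Function.update_self, Module.Basis.constr_range, Submodule.span_le]
    rintro _ ⟨t, rfl⟩
    exact generator_mem B _

theorem range_eq_generatedAt {B : Rep Q V} {φ : V' i →ₗ[ℂ] V i} (hφ : Function.Injective φ)
    (hd : Module.finrank ℂ (V i) = Module.finrank ℂ (V' i) + eps B i) :
    (LinearMap.range φ ≤ generatedAt B i → LinearMap.range φ = generatedAt B i) ∧
    (generatedAt B i ≤ LinearMap.range φ → LinearMap.range φ = generatedAt B i) := by
  have h1 := finrank_generatedAt_add_eps B i
  have h2 := LinearMap.finrank_range_of_inj hφ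
  exact ⟨fun h => Submodule.eq_of_le_of_finrank_eq h (by omega),
    fun h => (Submodule.eq_of_le_of_finrank_eq h (by omega)).symm⟩

theorem isPrincipalBundle_qMap (hS : ∀ k ∉ S, Subsingleton (V k))
    (hS' : ∀ k ∉ S, Subsingleton (V' k)) (hS'' : ∀ k ∉ S, Subsingleton (V'' k))
    (h'' : ∀ k ≠ i, Subsingleton (V'' k)) (hl : Module.finrank ℂ (V'' i) = l)
    (hd : ∀ k, Module.finrank ℂ (V k) = Module.finrank ℂ (V' k) + Module.finrank ℂ (V'' k)) :
    IsPrincipalBundle (A := GradedEnd V' × GradedEnd V'') gaugeAct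
      (extStratum Q V V' V'' l i) (nilStratum Q V l i) qMap := by
  have := finite_gradedHom (V' := V) hS'
  have := finite_gradedHom (V' := V'') hS
  have := finite_gradedHom (V' := V') hS
  have := finite_gradedHom (V' := V) hS
  have := finite_gradedHom (V' := V) hS''
  have := finite_gradedHom (V' := V') hS'
  have := finite_gradedHom (V' := V'') hS''
  have := finite_arrowHom Q hS hS
  have := finite_arrowHom Q hS' hS'
  have := finite_arrowHom Q hS'' hS''
  have hdi : ∀ B ∈ nilStratum Q V l i,
      Module.finrank ℂ (V i) = Module.finrank ℂ (V' i) + eps B i := fun B hB => by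
    rw [hd, hl, hB.2]
  have hrange : ∀ x ∈ extStratum Q V V' V'' l i,
      LinearMap.range (x.2.2.2.1 i) = generatedAt x.1 i := by
    rintro ⟨B, B', B'', φ, φ'⟩ hx
    obtain ⟨hB, hex, H, -⟩ := (mem_extStratum_iff hS hS' hS'').1 hx
    exact (range_eq_generatedAt (hex i).1 (hdi B hB)).2
      (H.generatedAt_le_range (surjective_of_exact h'' hex))
  -- Two points over the same `B` have the same subspace, so the quotient map of one kills the
  -- embedding of the other.
  have hcomp : ∀ x ∈ extStratum Q V V' V'' l i, ∀ y ∈ extStratum Q V V' V'' l i, x.1 = y.1 →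
      ∀ k z, x.2.2.2.2 k (y.2.2.2.1 k z) = 0 := by
    intro x hx y hy hxy k z
    by_cases hk : k = i
    · subst hk
      have h1 : y.2.2.2.1 k z ∈ LinearMap.range (x.2.2.2.1 k) := by
        rw [hrange x hx, hxy, ← hrange y hy]
        exact ⟨z, rfl⟩
      exact ((((mem_extStratum_iff hS hS' hS'').1 hx).2.1 k).2.1 _).2 h1
    · exact (h'' k hk).elim _ _
  have hact := isRegularOn_gaugeFun (Q := Q) hS hS' hS''
  refine ⟨fun x hx => hx.2, IsRegularOn.id.fst, fun g x => gaugeAct_mem hS hS' hS'' g,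
    fun x _ => gaugeAct_one x, fun g g' x _ => gaugeAct_mul g g' x,
    ⟨fun y => gaugeFun y.1 y.2, hact.mono (Set.prod_mono_right (Set.subset_univ _)),
      fun g x _ => gaugeFun_val g x⟩, fun g x _ => rfl, fun B₀ hB₀ => ?_⟩
  obtain ⟨φ, hφr, hφ₀, hφg⟩ := exists_regular_embedding (V' := V')
    (fun k hk => by
      have := h'' k hk
      rw [hd, Module.finrank_zero_of_subsingleton (M := V'' k), add_zero]) B₀
    (by have := hdi B₀ hB₀; have := finrank_generatedAt_add_eps B₀ i; omega)
  obtain ⟨φ₀', hex₀⟩ := exists_complement (V'' := V'') (φ B₀) hφ₀ hd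
  obtain ⟨ψ₀, s, h₀⟩ := exists_splitting hex₀
  -- `M B₀` is the identity, so its invertibility defines a neighbourhood of `B₀`, on which `φ B` is
  -- injective and split.
  let M : Rep Q V → GradedEnd V' := fun B k => ψ₀ k ∘ₗ φ B k
  let U : Set (Rep Q V) := {B | B ∈ nilStratum Q V l i ∧ IsUnit (M B)}
  let ψ : Rep Q V → GradedHom V V' := fun B k => Ring.inverse (M B) k ∘ₗ ψ₀ k
  let φ' : Rep Q V → GradedHom V V'' := fun B k => φ₀' k ∘ₗ (LinearMap.id - φ B k ∘ₗ ψ B k)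
  have hM : ∀ T, IsRegularOn T M := fun T => (IsRegularOn.const ψ₀).gradedComp (hφr T)
  have hψ : IsRegularOn U ψ :=
    ((hM U).ringInverse fun B hB => hB.2).gradedComp (IsRegularOn.const ψ₀)
  have hφ' : IsRegularOn U φ' := (IsRegularOn.const φ₀').gradedComp
    ((IsRegularOn.const (fun k => LinearMap.id)).sub ((hφr U).gradedComp hψ))
  have hsplit : ∀ B ∈ U, ∀ k, IsSplitting (φ B k) (φ' B k) (ψ B k) (s k) := fun B hB k =>
    (h₀ k).of_embedding
      (LinearMap.congr_fun (congrFun (Ring.inverse_mul_cancel _ hB.2) k))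
      (LinearMap.congr_fun (congrFun (Ring.mul_inverse_cancel _ hB.2) k))
  -- The local section of `q`: since the image of `φ B` is `generatedAt B i`, it is stable under
  -- `B`, which induces operators on the sub and the quotient.
  let sec : Rep Q V → ExtSpace Q V V' V'' := fun B =>
    (B, restrict (φ B) (ψ B) B, restrict s (φ' B) B, φ B, φ' B)
  have hsecr : IsRegularOn U sec := IsRegularOn.id.prodMk
    ((IsRegularOn.repComp hS' hS' hψ IsRegularOn.id (hφr U)).prodMk
      ((IsRegularOn.repComp hS'' hS'' hφ' IsRegularOn.id (IsRegularOn.const s)).prodMk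
        ((hφr U).prodMk hφ')))
  have hsec : ∀ B ∈ U, sec B ∈ extStratum Q V V' V'' l i := fun B hB => by
    have h0 : ∀ (a b : I) (h : Q.Arr a b) (x : V' a), φ' B b (B a b h (φ B a x)) = 0 := by
      intro a b h x
      by_cases hb : b = i
      · subst hb
        have hr := (range_eq_generatedAt (hsplit B hB b).injective (hdi B hB.1)).1 (hφg B)
        refine ((hsplit B hB b).exact _).2 ?_
        rw [← LinearMap.coe_range, SetLike.mem_coe, hr]
        by_cases ha : a = b
        · subst ha
          exact map_generatedAt_le B h ⟨_, hφg B ⟨x, rfl⟩, rfl⟩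
        · exact range_le_generatedAt B ha h ⟨_, rfl⟩
      · exact (h'' b hb).elim _ _
    exact (mem_extStratum_iff hS hS' hS'').2 ⟨hB.1, mem_sesVariety_of_splitting (hsplit B hB),
      intertwines_restrict (hsplit B hB) h0, intertwines_restrict_quotient (hsplit B hB) h0⟩
  let N : ExtSpace Q V V' V'' → GradedEnd V' := fun x k => ψ x.1 k ∘ₗ x.2.2.2.1 k
  let N' : ExtSpace Q V V' V'' → GradedEnd V'' := fun x k => x.2.2.2.2 k ∘ₗ s k
  have hNu : ∀ x ∈ extStratum Q V V' V'' l i ∩ qMap ⁻¹' U, IsUnit (N x) ∧ IsUnit (N' x) := by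
    rintro x ⟨hx, hxU⟩
    obtain ⟨ψx, sx, hs⟩ := exists_splitting ((mem_extStratum_iff hS hS' hS'').1 hx).2.1
    have hB := hsplit x.1 hxU
    have c1 := hcomp x hx _ (hsec x.1 hxU) rfl
    have c2 := hcomp _ (hsec x.1 hxU) x hx rfl
    constructor
    · refine ⟨⟨N x, fun k => ψx k ∘ₗ φ x.1 k, ?_, ?_⟩, rfl⟩
      · funext k
        ext z
        exact (hB k).comparison (hs k) (c1 k) z
      · funext k
        ext z
        exact (hs k).comparison (hB k) (c2 k) z
    · refine ⟨⟨N' x, fun k => φ' x.1 k ∘ₗ sx k, ?_, ?_⟩, rfl⟩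
      · funext k
        ext z
        exact (hB k).comparison_quotient (hs k) (c1 k) z
      · funext k
        ext z
        exact (hs k).comparison_quotient (hB k) (c2 k) z
  -- The trivialization moves `sec` by the group. As the group acts on `φ` through `g⁻¹`, `N x`
  -- recovers the inverse of the first component, hence the `Ring.inverse`; `N' x` recovers the
  -- second component directly.
  refine ⟨U, ⟨hB₀, ?_⟩, (hM _).isZariskiOpenIn_isUnit,
    fun y => gaugeFun y.2 (sec y.1), fun x => (x.1, Ring.inverse (N x), N' x), ⟨?_, ?_, ?_, ?_, ?_,
      ?_, fun _ _ => rfl⟩, ?_⟩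
  · rw [show M B₀ = 1 from funext fun k => LinearMap.ext fun x => (h₀ k).retraction x]
    exact isUnit_one
  · rintro ⟨B, _⟩ ⟨hB, g, rfl⟩
    dsimp only
    rw [gaugeFun_val]
    exact ⟨gaugeAct_mem hS hS' hS'' g (hsec B hB), hB⟩
  · intro x hx
    exact ⟨hx.2, Prod.isUnit_iff.2 ⟨(hNu x hx).1.ringInverse, (hNu x hx).2⟩⟩
  · rintro ⟨B, _⟩ ⟨hB, g, rfl⟩
    dsimp only
    rw [gaugeFun_val]
    have e1 : N (gaugeAct g (sec B)) = g.inv.1 := by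
      funext k
      ext z
      exact (hsplit B hB k).retraction _
    have e2 : N' (gaugeAct g (sec B)) = g.val.2 := by
      funext k
      ext z
      exact congrArg (g.val.2 k) ((hsplit B hB k).cosection _)
    rw [e1, e2, ringInverse_eq (congrArg Prod.fst g.inv_val) (congrArg Prod.fst g.val_inv)]
    rfl
  · intro x hx
    dsimp only
    obtain ⟨g, hg⟩ : IsUnit (Ring.inverse (N x), N' x) :=
      Prod.isUnit_iff.2 ⟨(hNu x hx).1.ringInverse, (hNu x hx).2⟩
    have hinv : g.inv.1 = N x := by
      have h1 : g.val.1 = Ring.inverse (N x) := by rw [hg]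
      have h2 : g.val.1 * g.inv.1 = 1 := congrArg Prod.fst g.val_inv
      rw [h1] at h2
      calc g.inv.1 = N x * Ring.inverse (N x) * g.inv.1 := by
            rw [Ring.mul_inverse_cancel _ (hNu x hx).1, one_mul]
        _ = N x := by rw [mul_assoc, h2, mul_one]
    have hval : g.val.2 = N' x := by rw [hg]
    rw [← hg, gaugeFun_val]
    refine extVariety_ext (gaugeAct_mem hS hS' hS'' g (hsec x.1 hx.2)).1 hx.1.1 rfl ?_
    have c1 := hcomp x hx.1 _ (hsec x.1 hx.2) rfl
    have c2 := hcomp _ (hsec x.1 hx.2) x hx.1 rfl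
    refine Prod.ext ?_ ?_
    · funext k
      ext z
      change φ x.1 k (g.inv.1 k z) = _
      rw [hinv]
      have := (hsplit x.1 hx.2 k).sum (x.2.2.2.1 k z)
      rw [show φ' x.1 k (x.2.2.2.1 k z) = 0 from c2 k z, map_zero, add_zero] at this
      exact this
    · funext k
      ext z
      change g.val.2 k (φ' x.1 k z) = _
      rw [hval]
      have := congrArg (x.2.2.2.2 k) ((hsplit x.1 hx.2 k).sum z)
      rw [map_add, show x.2.2.2.2 k (φ x.1 k _) = 0 from c1 k _, zero_add] at this
      exact this
  · have := hsecr.comp (S := U ×ˢ unitsVariety (GradedEnd V' × GradedEnd V''))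
      IsRegularOn.id.fst fun y hy => hy.1
    exact hact.comp (IsRegularOn.id.snd.prodMk this) fun y hy => ⟨hy.2, trivial⟩
  · have hx := IsRegularOn.id (S := extStratum Q V V' V'' l i ∩ qMap ⁻¹' U)
    have h1 := hψ.comp hx.fst fun x hx => hx.2
    have hN : IsRegularOn (extStratum Q V V' V'' l i ∩ qMap ⁻¹' U) N :=
      h1.gradedComp hx.snd.snd.snd.fst
    exact hx.fst.prodMk ((hN.ringInverse fun x hx => (hNu x hx).1).prodMk
      (hx.snd.snd.snd.snd.gradedComp (IsRegularOn.const s)))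
  · intro B hB g g'
    dsimp only
    rw [gaugeFun_val, gaugeFun_val, gaugeAct_mul]

end LocalEmbedding

/-! ## The affine fibration -/

section KernelProjection

variable {C G : Type*} [AddCommGroup C] [Module ℂ C] [AddCommGroup G] [Module ℂ G]
  {L₀ L : C →ₗ[ℂ] G} {R₀ : G →ₗ[ℂ] C}

/-- The projection to the kernel of `L` along the image of `R₀`. -/
noncomputable def kerProj (R₀ : G →ₗ[ℂ] C) (L : C →ₗ[ℂ] G) : C →ₗ[ℂ] C :=
  LinearMap.id - R₀ ∘ₗ (Ring.inverse (L ∘ₗ R₀ : Module.End ℂ G) : Module.End ℂ G) ∘ₗ L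

theorem map_kerProj (hu : IsUnit (L ∘ₗ R₀ : Module.End ℂ G)) (c : C) : L (kerProj R₀ L c) = 0 := by
  have h : ∀ y, L (R₀ ((Ring.inverse (L ∘ₗ R₀ : Module.End ℂ G) : Module.End ℂ G) y)) = y :=
    LinearMap.congr_fun (Ring.mul_inverse_cancel _ hu)
  simp [kerProj, h]

/-- With `toKer_kerProj`, this makes `kerProj` and `toKer` inverse bijections between `ker L₀` and
`ker L`: both are complements of the image of `R₀` when `L ∘ R₀` is invertible. -/
theorem kerProj_sub (hu : IsUnit (L ∘ₗ R₀ : Module.End ℂ G)) {c : C} (hc : L c = 0) (y : G) :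
    kerProj R₀ L (c - R₀ y) = c := by
  have h : ∀ y, (Ring.inverse (L ∘ₗ R₀ : Module.End ℂ G) : Module.End ℂ G) (L (R₀ y)) = y :=
    LinearMap.congr_fun (Ring.inverse_mul_cancel _ hu)
  simp [kerProj, h, hc]

/-- The projection to the kernel of `L₀` along the image of a right inverse. -/
noncomputable def toKer (h : L₀ ∘ₗ R₀ = LinearMap.id) : C →ₗ[ℂ] LinearMap.ker L₀ :=
  (LinearMap.id - R₀ ∘ₗ L₀).codRestrict _ fun c => by
    have := LinearMap.congr_fun h (L₀ c)
    simp only [LinearMap.comp_apply, LinearMap.id_apply] at this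
    simp [this]

theorem coe_toKer (h : L₀ ∘ₗ R₀ = LinearMap.id) (c : C) : (toKer h c : C) = c - R₀ (L₀ c) := rfl

theorem toKer_kerProj (h : L₀ ∘ₗ R₀ = LinearMap.id) (c : LinearMap.ker L₀) :
    toKer h (kerProj R₀ L c) = c := by
  have h1 : ∀ y, L₀ (R₀ y) = y := LinearMap.congr_fun h
  ext
  simp [coe_toKer, kerProj, h1]

end KernelProjection

section Fibration

variable {I : Type u} {Q : DoubleQuiver.{u, v} I}
  {V : I → Type w} {V' : I → Type w'} {V'' : I → Type w''}
  [∀ k, AddCommGroup (V k)] [∀ k, Module ℂ (V k)]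
  [∀ k, AddCommGroup (V' k)] [∀ k, Module ℂ (V' k)]
  [∀ k, AddCommGroup (V'' k)] [∀ k, Module ℂ (V'' k)]
  {S : Finset I} {i : I} {l : ℕ}

/-- The part of the operators on an extension that comes from an off-diagonal component. -/
def glueOff (φ : GradedHom V' V) (φ' : GradedHom V V'') : ArrowHom Q V'' V' →ₗ[ℂ] Rep Q V where
  toFun C := fun a b h => φ b ∘ₗ C a b h ∘ₗ φ' a
  map_add' _ _ := by funext; simp [LinearMap.add_comp, LinearMap.comp_add]
  map_smul' _ _ := by funext; simp [LinearMap.smul_comp, LinearMap.comp_smul]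

theorem glue_eq_add (φ : GradedHom V' V) (φ' : GradedHom V V'') (ψ : GradedHom V V')
    (s : GradedHom V'' V) (B' : Rep Q V') (B'' : Rep Q V'') (C : ArrowHom Q V'' V') :
    glue φ φ' ψ s B' B'' C = glueOff φ φ' C + glue φ φ' ψ s B' B'' 0 := by
  funext a b h
  simp [glue, glueOff, add_comm]

variable [∀ k, FiniteDimensional ℂ (V k)] [∀ k, FiniteDimensional ℂ (V' k)]
  [∀ k, FiniteDimensional ℂ (V'' k)]

/-- Only arrows starting at `i` contribute, because `V''` vanishes elsewhere. -/
theorem finrank_arrowHom (hS' : ∀ k ∉ S, Subsingleton (V' k)) (hS'' : ∀ k ∉ S, Subsingleton (V'' k))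
    (h'' : ∀ k ≠ i, Subsingleton (V'' k)) (hi : i ∈ S) :
    Module.finrank ℂ (ArrowHom Q V'' V') =
      ∑ b ∈ S, numArr Q i b * (Module.finrank ℂ (V'' i) * Module.finrank ℂ (V' b)) := by
  have := fun a b => Q.finite_arr a b
  have := finite_arrowHom_from (V := V'') Q hS'
  rw [finrank_pi_of_subsingleton (S := S) fun a ha => by have := hS'' a ha; infer_instance,
    Finset.sum_eq_single i, finrank_pi_of_subsingleton (S := S) fun b hb => by
      have := hS' b hb; infer_instance]
  · refine Finset.sum_congr rfl fun b _ => ?_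
    have := Fintype.ofFinite (Q.Arr i b)
    rw [Module.finrank_pi_fintype, Finset.sum_const, Module.finrank_linearMap, numArr,
      Nat.card_eq_fintype_card, Finset.card_univ, smul_eq_mul]
  · intro a _ ha
    have := h'' a ha
    exact Module.finrank_zero_of_subsingleton
  · exact fun h => absurd hi h

theorem finrank_gradedHom (h'' : ∀ k ≠ i, Subsingleton (V'' k)) :
    Module.finrank ℂ (GradedHom V'' V') =
      Module.finrank ℂ (V'' i) * Module.finrank ℂ (V' i) := by
  rw [finrank_pi_of_subsingleton (S := {i}) fun k hk => by
    have := h'' k (by simpa using hk); infer_instance, Finset.sum_singleton,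
    Module.finrank_linearMap]

theorem isRegularOn_extMoment {E : Type*} [AddCommGroup E] [Module ℂ E] {T : Set E}
    (hS' : ∀ k ∉ S, Subsingleton (V' k)) (hS'' : ∀ k ∉ S, Subsingleton (V'' k))
    {B' : E → Rep Q V'} {B'' : E → Rep Q V''} (hB' : IsRegularOn T B') (hB'' : IsRegularOn T B'') :
    IsRegularOn T fun x => extMoment S (B' x) (B'' x) := by
  have := finite_arrowHom Q hS'' hS'
  have := finite_gradedHom (V' := V') hS''
  refine IsRegularOn.hom fun C => IsRegularOn.pi fun k => ?_
  refine IsRegularOn.sum (arrows Q k S) (f := fun h x => sgn h.2 •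
    (B' x h.1 k (Q.bar h.2) ∘ₗ C k h.1 h.2 + C h.1 k (Q.bar h.2) ∘ₗ B'' x k h.1 h.2)) fun h _ => ?_
  exact IsRegularOn.smul (IsRegularFunOn.const _) (((((hB'.proj _).proj _).proj _).comp_hom
    (IsRegularOn.const _)).add ((IsRegularOn.const _).comp_hom (((hB''.proj _).proj _).proj _)))

/-- The fibre over `u` is identified with the kernel of `extMoment` at `u`, and that kernel with the
one at `m`. The last two conclusions, `B` affine in the fibre coordinate and the coordinate linear
in `B`, are what make any two charts differ by an affine map. -/
theorem exists_local_trivialization (hS : ∀ k ∉ S, Subsingleton (V k))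
    (hS' : ∀ k ∉ S, Subsingleton (V' k)) (hS'' : ∀ k ∉ S, Subsingleton (V'' k))
    (h'' : ∀ k ≠ i, Subsingleton (V'' k)) (hl : Module.finrank ℂ (V'' i) = l) {n : ℕ}
    (m : (Rep Q V' × Rep Q V'') × (GradedHom V' V × GradedHom V V''))
    (hm : m ∈ regProduct Q V' V'' 0 i ×ˢ sesVariety V V' V'')
    (hn : n + Module.finrank ℂ (GradedHom V'' V') = Module.finrank ℂ (ArrowHom Q V'' V')) :
    ∃ (U : Set ((Rep Q V' × Rep Q V'') × (GradedHom V' V × GradedHom V V'')))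
      (σ : ((Rep Q V' × Rep Q V'') × (GradedHom V' V × GradedHom V V'')) × (Fin n → ℂ) →
        ExtSpace Q V V' V'')
      (τ : ExtSpace Q V V' V'' →
        ((Rep Q V' × Rep Q V'') × (GradedHom V' V × GradedHom V V'')) × (Fin n → ℂ)),
      (m ∈ U ∧ IsZariskiOpenIn (regProduct Q V' V'' 0 i ×ˢ sesVariety V V' V'') U ∧
        IsTrivialization (extStratum Q V V' V'' l i) pMap' U Set.univ σ τ) ∧
      (∀ u, ∃ t : (Fin n → ℂ) →ᵃ[ℂ] Rep Q V, ∀ z, (σ (u, z)).1 = t z) ∧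
      ∀ u, ∃ t : Rep Q V →ₗ[ℂ] (Fin n → ℂ), ∀ x, pMap' x = u → (τ x).2 = t x.1 := by
  have := finite_gradedHom (V' := V) hS'
  have := finite_gradedHom (V' := V'') hS
  have := finite_gradedHom (V' := V') hS
  have := finite_gradedHom (V' := V) hS
  have := finite_gradedHom (V' := V) hS''
  have := finite_gradedHom (V' := V') hS''
  have := finite_gradedHom (V' := V') hS'
  have := finite_gradedHom (V' := V'') hS''
  have := finite_arrowHom Q hS hS
  have := finite_arrowHom Q hS' hS'
  have := finite_arrowHom Q hS'' hS''
  have := finite_arrowHom Q hS'' hS'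
  obtain ⟨ψ₀, s₀, h₀⟩ := exists_splitting hm.2
  let L : ((Rep Q V' × Rep Q V'') × (GradedHom V' V × GradedHom V V'')) →
    (ArrowHom Q V'' V' →ₗ[ℂ] GradedHom V'' V') := fun u => extMoment S u.1.1 u.1.2
  have hL₀ : Function.Surjective (L m) := extMoment_surjective inferInstance hS' h''
    (eps_eq_zero_iff.1 hm.1.1.2) _
  obtain ⟨R₀, hR₀⟩ := (L m).exists_rightInverse_of_surjective (LinearMap.range_eq_top.2 hL₀)
  have hker : Module.finrank ℂ (LinearMap.ker (L m)) = n := by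
    have := (L m).finrank_range_add_finrank_ker
    rw [LinearMap.range_eq_top.2 hL₀, finrank_top] at this
    omega
  let κ : (Fin n → ℂ) ≃ₗ[ℂ] LinearMap.ker (L m) := LinearEquiv.ofFinrankEq _ _ (by simp [hker])
  let a : ((Rep Q V' × Rep Q V'') × (GradedHom V' V × GradedHom V V'')) → GradedEnd V' :=
    fun u k => ψ₀ k ∘ₗ u.2.1 k
  let c : ((Rep Q V' × Rep Q V'') × (GradedHom V' V × GradedHom V V'')) → GradedEnd V'' :=
    fun u k => u.2.2 k ∘ₗ s₀ k
  let e : ((Rep Q V' × Rep Q V'') × (GradedHom V' V × GradedHom V V'')) →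
    Module.End ℂ (GradedHom V'' V') := fun u => L u ∘ₗ R₀
  let D : ((Rep Q V' × Rep Q V'') × (GradedHom V' V × GradedHom V V'')) →
    GradedEnd V' × GradedEnd V'' × Module.End ℂ (GradedHom V'' V') := fun u => (a u, c u, e u)
  -- One unit condition in a product algebra encodes three: the old splitting still compares with
  -- the new sequence on both sides, and `R₀` still maps onto a complement of the kernel. All three
  -- maps are the identity at `m`.
  let U := {u | u ∈ regProduct Q V' V'' 0 i ×ˢ sesVariety V V' V'' ∧ IsUnit (D u)}
  have hUa : ∀ u ∈ U, IsUnit (a u) := fun u hu => (Prod.isUnit_iff.1 hu.2).1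
  have hUc : ∀ u ∈ U, IsUnit (c u) := fun u hu => (Prod.isUnit_iff.1 (Prod.isUnit_iff.1 hu.2).2).1
  have hUe : ∀ u ∈ U, IsUnit (e u) := fun u hu => (Prod.isUnit_iff.1 (Prod.isUnit_iff.1 hu.2).2).2
  let s : ((Rep Q V' × Rep Q V'') × (GradedHom V' V × GradedHom V V'')) → GradedHom V'' V :=
    fun u k => s₀ k ∘ₗ Ring.inverse (c u) k
  let ψ : ((Rep Q V' × Rep Q V'') × (GradedHom V' V × GradedHom V V'')) → GradedHom V V' :=
    fun u k => Ring.inverse (a u) k ∘ₗ ψ₀ k ∘ₗ (LinearMap.id - s₀ k ∘ₗ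
      Ring.inverse (c u) k ∘ₗ u.2.2 k)
  have hsplit : ∀ u ∈ U, ∀ k, IsSplitting (u.2.1 k) (u.2.2 k) (ψ u k) (s u k) := fun u hu k =>
    IsSplitting.of_exact (hu.1.2 k).2.1
      (LinearMap.congr_fun (congrFun (Ring.inverse_mul_cancel _ (hUa u hu)) k))
      (LinearMap.congr_fun (congrFun (Ring.mul_inverse_cancel _ (hUc u hu)) k))
  have hid : ∀ T, IsRegularOn T
      fun u : (Rep Q V' × Rep Q V'') × (GradedHom V' V × GradedHom V V'') => u :=
    fun T => IsRegularOn.id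
  have hLr : ∀ T, IsRegularOn T L := fun T =>
    isRegularOn_extMoment hS' hS'' (hid T).fst.fst (hid T).fst.snd
  have har : ∀ T, IsRegularOn T a := fun T => (IsRegularOn.const ψ₀).gradedComp (hid T).snd.fst
  have hcr : ∀ T, IsRegularOn T c := fun T => (hid T).snd.snd.gradedComp (IsRegularOn.const s₀)
  have her : ∀ T, IsRegularOn T e := fun T => (hLr T).comp_hom (IsRegularOn.const R₀)
  have hsr : IsRegularOn U s := (IsRegularOn.const s₀).gradedComp ((hcr U).ringInverse hUc)
  have hψr : IsRegularOn U ψ := ((har U).ringInverse hUa).gradedComp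
    ((IsRegularOn.const ψ₀).gradedComp ((IsRegularOn.const fun k => LinearMap.id).sub
      ((IsRegularOn.const s₀).gradedComp (((hcr U).ringInverse hUc).gradedComp (hid U).snd.snd))))
  have hkr : IsRegularOn U fun u => kerProj R₀ (L u) := (IsRegularOn.const LinearMap.id).sub
    ((IsRegularOn.const R₀).comp_hom (((her U).ringInverse hUe).comp_hom (hLr U)))
  -- Fibre coordinates parametrize the kernel at `m`, then are projected to the kernel at `u` along
  -- the image of `R₀`.
  let off : ((Rep Q V' × Rep Q V'') × (GradedHom V' V × GradedHom V V'')) →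
    (Fin n → ℂ) →ₗ[ℂ] ArrowHom Q V'' V' := fun u =>
      kerProj R₀ (L u) ∘ₗ (LinearMap.ker (L m)).subtype ∘ₗ κ.toLinearMap
  let coord : ArrowHom Q V'' V' →ₗ[ℂ] (Fin n → ℂ) := κ.symm.toLinearMap ∘ₗ toKer hR₀
  let g : ((Rep Q V' × Rep Q V'') × (GradedHom V' V × GradedHom V V'')) →
    ArrowHom Q V'' V' → Rep Q V := fun u => glue u.2.1 u.2.2 (ψ u) (s u) u.1.1 u.1.2
  have hmem : ∀ u ∈ U, ∀ B, (B, u.1.1, u.1.2, u.2.1, u.2.2) ∈ extStratum Q V V' V'' l i →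
      L u (offDiagonal (ψ u) (s u) B) = 0 ∧ g u (offDiagonal (ψ u) (s u) B) = B := by
    intro u hu B hB
    obtain ⟨h1, h2, h3, h4, h5⟩ := (mem_extStratum_iff_regProduct hS hS' hS'' h'' hl).1 hB
    have h6 := glue_offDiagonal (hsplit u hu) h3 h4
    refine ⟨(momentMap_glue_eq_zero_iff hS hS' hS'' (hsplit u hu) _ h1.1.1.2.1 h1.2.1.2.1).1 ?_,
      h6⟩
    rwa [h6]
  have hmem' : ∀ u ∈ U, ∀ C, L u C = 0 →
      (g u C, u.1.1, u.1.2, u.2.1, u.2.2) ∈ extStratum Q V V' V'' l i := fun u hu C hC =>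
    (mem_extStratum_iff_regProduct hS hS' hS'' h'' hl).2 ⟨hu.1.1, hu.1.2,
      intertwines_glue (hsplit u hu) C, intertwines_glue_quotient (hsplit u hu) C,
      (momentMap_glue_eq_zero_iff hS hS' hS'' (hsplit u hu) _ hu.1.1.1.1.2.1
        hu.1.1.2.1.2.1).2 hC⟩
  refine ⟨U, fun y => (g y.1 (off y.1 y.2), y.1.1.1, y.1.1.2, y.1.2.1, y.1.2.2),
    fun x => (pMap' x, coord (offDiagonal (ψ (pMap' x)) (s (pMap' x)) x.1)),
    ⟨⟨hm, ?_⟩, ?_, ⟨?_, ?_, ?_, ?_, ?_, ?_, fun _ _ => rfl⟩⟩, fun u => ?_, fun u => ?_⟩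
  · have h1 : a m = 1 := funext fun k => LinearMap.ext fun x => (h₀ k).retraction x
    have h2 : c m = 1 := funext fun k => LinearMap.ext fun x => (h₀ k).cosection x
    have h3 : e m = 1 := hR₀
    change IsUnit (a m, c m, e m)
    rw [h1, h2, h3]
    exact isUnit_one
  · exact ((har _).prodMk ((hcr _).prodMk (her _))).isZariskiOpenIn_isUnit
  · rintro ⟨u, z⟩ ⟨hu, -⟩
    exact ⟨hmem' u hu _ (map_kerProj (hUe u hu) _), hu⟩
  · rintro x ⟨-, hx⟩
    exact ⟨hx, trivial⟩
  · rintro ⟨u, z⟩ ⟨hu, -⟩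
    refine Prod.ext rfl ?_
    change coord (offDiagonal (ψ u) (s u) (g u (off u z))) = z
    rw [offDiagonal_glue (hsplit u hu)]
    change κ.symm (toKer hR₀ (kerProj R₀ (L u) (κ z))) = z
    rw [toKer_kerProj, κ.symm_apply_apply]
  · rintro x ⟨hx, hxU⟩
    obtain ⟨h1, h2⟩ := hmem (pMap' x) hxU x.1 hx
    refine Prod.ext ?_ rfl
    change g (pMap' x) (kerProj R₀ (L (pMap' x)) (κ (κ.symm (toKer hR₀ _)))) = x.1
    rw [κ.apply_symm_apply, coe_toKer, kerProj_sub (hUe _ hxU) h1, h2]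
  · have hy := IsRegularOn.id (S := U ×ˢ (Set.univ : Set (Fin n → ℂ)))
    have hy1 : Set.MapsTo (fun y : ((Rep Q V' × Rep Q V'') × (GradedHom V' V × GradedHom V V''))
      × (Fin n → ℂ) => y.1) (U ×ˢ Set.univ) U := fun y hy => hy.1
    have hψ := hψr.comp hy.fst hy1
    have hs := hsr.comp hy.fst hy1
    have hoff := IsRegularOn.bilinear LinearMap.id (hkr.comp hy.fst hy1) (hy.snd.linear_comp
      ((LinearMap.ker (L m)).subtype ∘ₗ κ.toLinearMap))
    have hg := ((IsRegularOn.repComp hS hS hy.fst.snd.fst hy.fst.fst.fst hψ).add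
      (IsRegularOn.repComp hS hS hs hy.fst.fst.snd hy.fst.snd.snd)).add
      (IsRegularOn.repComp hS hS hy.fst.snd.fst hoff hy.fst.snd.snd)
    exact IsRegularOn.prodMk (hg.congr fun _ _ => rfl) (hy.fst.fst.fst.prodMk
      (hy.fst.fst.snd.prodMk (hy.fst.snd.fst.prodMk hy.fst.snd.snd)))
  · have hx := IsRegularOn.id (S := extStratum Q V V' V'' l i ∩ pMap' ⁻¹' U)
    have hp : IsRegularOn (extStratum Q V V' V'' l i ∩ pMap' ⁻¹' U)
        (pMap' : ExtSpace Q V V' V'' → _) :=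
      (hx.snd.fst.prodMk hx.snd.snd.fst).prodMk hx.snd.snd.snd
    have hpU : Set.MapsTo pMap' (extStratum Q V V' V'' l i ∩ pMap' ⁻¹' U) U := fun x hx => hx.2
    exact hp.prodMk ((IsRegularOn.repComp hS'' hS' (hψr.comp hp hpU) hx.fst
      (hsr.comp hp hpU)).linear_comp coord)
  · refine ⟨(glueOff u.2.1 u.2.2 ∘ₗ off u).toAffineMap + AffineMap.const ℂ _ (g u 0), fun z => ?_⟩
    exact glue_eq_add _ _ _ _ _ _ _
  · refine ⟨coord ∘ₗ offDiagonal (ψ u) (s u), ?_⟩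
    rintro x rfl
    rfl

theorem isAffineFibration_pMap' (hS : ∀ k ∉ S, Subsingleton (V k))
    (hS' : ∀ k ∉ S, Subsingleton (V' k)) (hS'' : ∀ k ∉ S, Subsingleton (V'' k))
    (h'' : ∀ k ≠ i, Subsingleton (V'' k)) (hl : Module.finrank ℂ (V'' i) = l) :
    IsAffineFibration (extStratum Q V V' V'' l i)
      (regProduct Q V' V'' 0 i ×ˢ sesVariety V V' V'') pMap'
      ((Module.finrank ℂ (ArrowHom Q V'' V') : ℤ) - Module.finrank ℂ (GradedHom V'' V')) := by
  have := finite_gradedHom (V' := V) hS'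
  have := finite_gradedHom (V' := V'') hS
  have := finite_gradedHom (V' := V') hS''
  have := finite_arrowHom Q hS' hS'
  have := finite_arrowHom Q hS'' hS''
  have := finite_arrowHom Q hS'' hS'
  have hid := IsRegularOn.id (S := extStratum Q V V' V'' l i)
  refine ⟨?_, (hid.snd.fst.prodMk hid.snd.snd.fst).prodMk hid.snd.snd.snd, ?_⟩
  · rintro ⟨B, B', B'', φ, φ'⟩ hx
    have := (mem_extStratum_iff_regProduct hS hS' hS'' h'' hl).1 hx
    exact ⟨this.1, this.2.1⟩
  obtain ⟨n, hn⟩ : ∃ n : ℕ, (regProduct Q V' V'' 0 i ×ˢ sesVariety V V' V'').Nonempty →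
      n + Module.finrank ℂ (GradedHom V'' V') = Module.finrank ℂ (ArrowHom Q V'' V') := by
    -- The truncated subtraction is genuine once the target has a point, since `extMoment` is then
    -- surjective; over an empty target its value is irrelevant.
    refine ⟨Module.finrank ℂ (ArrowHom Q V'' V') - Module.finrank ℂ (GradedHom V'' V'), ?_⟩
    rintro ⟨m, hm⟩
    exact Nat.sub_add_cancel (LinearMap.finrank_le_finrank_of_surjective
      (extMoment_surjective (S := S) inferInstance hS' h'' (eps_eq_zero_iff.1 hm.1.1.2) m.1.2))
  choose! U σ τ h1 h2 h3 using fun m hm =>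
    exists_local_trivialization hS hS' hS'' h'' hl m hm (hn ⟨m, hm⟩)
  refine ⟨n, fun h => by have := hn h; omega, U, σ, τ, h1, fun m hm m' hm' u hu => ?_⟩
  obtain ⟨t, ht⟩ := h2 m hm u
  obtain ⟨t', ht'⟩ := h3 m' hm' u
  refine ⟨t'.toAffineMap.comp t, fun z => ?_⟩
  have hT := (h1 m hm).2.2
  have hz : (u, z) ∈ U m ×ˢ (Set.univ : Set (Fin n → ℂ)) := ⟨hu.1, trivial⟩
  have := hT.over_base _ (hT.mapsTo hz)
  rw [hT.inv_left hz] at this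
  rw [ht' _ this.symm, ht]
  rfl

end Fibration

/-! ### The rank in terms of the Cartan matrix. -/

section Rank

variable {I : Type*} [DecidableEq I] (Q : DoubleQuiver I) (α : I →₀ ℕ) (i : I)

theorem sum_numArr (i : I) :
    ∑ b ∈ insert i α.support, (numArr Q i b : ℤ) * α b =
      ∑ j ∈ α.support with j ≠ i, (numArr Q i j : ℤ) * (α j : ℤ) + numArr Q i i * α i := by
  rw [← Finset.sum_filter_add_sum_filter_not (insert i α.support) (fun j => j ≠ i)]
  congr 1
  · rw [Finset.filter_insert, if_neg (by simp)]
  · rw [show (insert i α.support).filter (fun j => ¬ j ≠ i) = {i} by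
      ext j; simp +contextual, Finset.sum_singleton]

theorem pairing_single_eq (l : ℕ) :
    (l : ℤ) * (∑ j ∈ α.support with j ≠ i, (numArr Q i j : ℤ) * (α j : ℤ)
          + ((numArr Q i i : ℤ) - 1) * (α i : ℤ)) =
      pairing (Finsupp.single i (l : ℤ)) (⇑(toRoot α) - cartanMul Q (toRoot α)) := by
  have h1 : cartanMul Q (toRoot α) i = ∑ b ∈ insert i α.support, cartan Q i b * (α b : ℤ) := by
    refine (Finsupp.sum_of_support_subset _ ?_ _ (by simp)).trans rfl
    exact (Finsupp.support_mapRange).trans (Finset.subset_insert _ _)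
  -- The matrix of arrow numbers plus the Cartan matrix is twice the identity, so `(Id - A) α` at
  -- `i` equals `∑ c_ib α_b - α_i`.
  have h2 : ∑ b ∈ insert i α.support, (cartan Q i b + numArr Q i b) * (α b : ℤ) =
      2 * α i := by
    rw [Finset.sum_eq_single i]
    · simp [cartan]
    · intro b _ hb
      simp [cartan, hb.symm]
    · intro h
      simp at h
  simp only [add_mul, Finset.sum_add_distrib] at h2
  rw [sum_numArr, ← h1] at h2
  rw [pairing, Finsupp.sum_single_index (by simp), Pi.sub_apply]
  have h3 : toRoot α i = α i := rfl
  rw [h3]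
  linear_combination (l : ℤ) * h2

end Rank

end LoopQuiver

theorem proposition3p1 {I : Type*} [DecidableEq I] (Q : DoubleQuiver I)
    (α : I →₀ ℕ) (l : ℕ) (i : I) (V V' V'' : I → Type*)
    [∀ k, AddCommGroup (V k)] [∀ k, Module ℂ (V k)] [∀ k, FiniteDimensional ℂ (V k)]
    [∀ k, AddCommGroup (V' k)] [∀ k, Module ℂ (V' k)] [∀ k, FiniteDimensional ℂ (V' k)]
    [∀ k, AddCommGroup (V'' k)] [∀ k, Module ℂ (V'' k)] [∀ k, FiniteDimensional ℂ (V'' k)]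
    (hV' : ∀ k, Module.finrank ℂ (V' k) = α k)
    (hV'' : ∀ k, Module.finrank ℂ (V'' k) = Finsupp.single i l k)
    (hV : ∀ k, Module.finrank ℂ (V k) = (α + Finsupp.single i l) k) :
    IsPrincipalBundle (A := GradedEnd V' × GradedEnd V'') gaugeAct
        (extStratum Q V V' V'' l i) (nilStratum Q V l i) qMap ∧
    (∀ x ∈ extStratum Q V V' V'' l i, pMap x = Prod.fst (pMap' x)) ∧
    IsAffineFibration (extStratum Q V V' V'' l i)
        (regProduct Q V' V'' 0 i ×ˢ sesVariety V V' V'') pMap'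
        ((l : ℤ) * (∑ j ∈ α.support with j ≠ i, (numArr Q i j : ℤ) * (α j : ℤ)
          + ((numArr Q i i : ℤ) - 1) * (α i : ℤ))) ∧
    (l : ℤ) * (∑ j ∈ α.support with j ≠ i, (numArr Q i j : ℤ) * (α j : ℤ)
          + ((numArr Q i i : ℤ) - 1) * (α i : ℤ)) =
      pairing (Finsupp.single i (l : ℤ)) (⇑(toRoot α) - cartanMul Q (toRoot α)) := by
  have h'' : ∀ k ≠ i, Subsingleton (V'' k) := fun k hk =>
    Module.finrank_zero_iff.1 ((hV'' k).trans (Finsupp.single_eq_of_ne hk))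
  have hl : Module.finrank ℂ (V'' i) = l := (hV'' i).trans Finsupp.single_eq_same
  have hd : ∀ k, Module.finrank ℂ (V k) = Module.finrank ℂ (V' k) + Module.finrank ℂ (V'' k) :=
    fun k => by rw [hV, hV', hV'', Finsupp.add_apply]
  -- The set `insert i α.support` supports all three graded spaces, even when `α i = 0`.
  have hS' : ∀ k ∉ insert i α.support, Subsingleton (V' k) := fun k hk => by
    simp only [Finset.mem_insert, Finsupp.mem_support_iff, not_or, not_not] at hk
    exact Module.finrank_zero_iff.1 ((hV' k).trans hk.2)
  have hS'' : ∀ k ∉ insert i α.support, Subsingleton (V'' k) := fun k hk =>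
    h'' k fun h => hk (by simp [h])
  have hS : ∀ k ∉ insert i α.support, Subsingleton (V k) := fun k hk => by
    have := hS' k hk
    have := hS'' k hk
    refine (Module.finrank_zero_iff (R := ℂ)).1 ?_
    rw [hd, Module.finrank_zero_of_subsingleton, Module.finrank_zero_of_subsingleton]
  refine ⟨isPrincipalBundle_qMap hS hS' hS'' h'' hl hd, fun x _ => rfl, ?_,
    pairing_single_eq Q α i l⟩
  have hr := isAffineFibration_pMap' (Q := Q) (l := l) hS hS' hS'' h'' hl
  -- The rank becomes `∑ c_ib l α_b - l α_i`, over `b` in `insert i α.support`.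
  rw [finrank_arrowHom hS' hS'' h'' (Finset.mem_insert_self _ _), finrank_gradedHom h'', hl] at hr
  convert hr using 1
  have := sum_numArr Q α i
  simp only [hV']
  push_cast
  simp only [mul_left_comm _ (l : ℤ), ← Finset.mul_sum]
  rw [this]
  ring
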